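/- **Setting (Dedukti with confinement, and the theory $\mathbb{UPP}$).** *Levels* are given by $l ::= i \mid 0 \mid \mathsf S\,l \mid l\sqcup l'$, where $i$ ranges over confined variables. *Terms* are given by $$A,B,t,u ::= x \mid c \mid s \mid (x:A)\to B \mid x.\,t \mid t\,u \mid (i:A)\to B \mid i.\,t \mid t\,l,\qquad s\in\{\mathrm{Type},\mathrm{Kind}\},$$ up to renaming of bound variables; $c$ ranges over the global constants $\mathsf{Lvl},\mathsf{Ty},\mathsf{Tm},\mathsf U,\Pi,\lambda,@$ and over local constants. A *local signature* $\Phi'$ is a finite list of entries $c:A$ or $c:A:=t$ for pairwise distinct local constants $c$. The global constants have the types $$\begin{aligned} &\mathsf{Lvl}:\mathrm{Type},\quad \mathsf{Ty}:(l:\mathsf{Lvl})\to\mathrm{Type},\quad \mathsf{Tm}:(l:\mathsf{Lvl})\to\mathsf{Ty}\,l\to\mathrm{Type},\quad \mathsf U:(l:\mathsf{Lvl})\to\mathsf{Ty}\,(\mathsf S\,l),\\ &\Pi:(l\,l':\mathsf{Lvl})\to(A:\mathsf{Ty}\,l)\to(B:\mathsf{Tm}\,l\,A\to\mathsf{Ty}\,l')\to\mathsf{Ty}\,(l\sqcup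 l'),\\ &\lambda:(l\,l':\mathsf{Lvl})\to(A:\mathsf{Ty}\,l)\to(B:\mathsf{Tm}\,l\,A\to\mathsf{Ty}\,l')\to((x:\mathsf{Tm}\,l\,A)\to\mathsf{Tm}\,l'\,(B\,x))\to\mathsf{Tm}\,(l\sqcup l')\,(\Pi\,l\,l'\,A\,B),\\ &@:(l\,l':\mathsf{Lvl})\to(A:\mathsf{Ty}\,l)\to(B:\mathsf{Tm}\,l\,A\to\mathsf{Ty}\,l')\to(t:\mathsf{Tm}\,(l\sqcup l')\,(\Pi\,l\,l'\,A\,B))\to(u:\mathsf{Tm}\,l\,A)\to\mathsf{Tm}\,l'\,(B\,u). \end{aligned}$$ Let $\longrightarrow$ be the closure by context of the following rules: $(x.t)\,u\to t[x\mapsto u]$; $(i.t)\,l\to t[i\mapsto l]$; $c\to t$ for $c:A:=t$ in $\Phi'$; $\mathsf{Tm}\,l'\,(\mathsf U\,l)\to\mathsf{Ty}\,l$; and $@\,l\,l'\,A\,B\,(\lambda\,l''\,l'''\,A'\,B'\,t)\,u\to t\,u$. Let $\simeq$ be the congruence on levels and terms generated by all instances of $l_1\sqcup(l_2\sqcup l_3)\simeq(l_1\sqcup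 l_2)\sqcup l_3$, $l_1\sqcup l_2\simeq l_2\sqcup l_1$, $\mathsf S(l_1\sqcup l_2)\simeq\mathsf S\,l_1\sqcup\mathsf S\,l_2$, $l\sqcup\mathsf S\,l\simeq\mathsf S\,l$, $l\sqcup 0\simeq l$, $l\sqcup l\simeq l$. Let $\equiv$ be the equivalence relation generated by $\longrightarrow\cup\simeq$. *Contexts* are finite lists of entries $x:A$ or $i:A$ for distinct variables. The judgments $\Gamma\vdash$, $\Gamma\vdash t:A$, $\Gamma\vdash l:A$ are inductively defined as follows. - $\cdot\vdash$. If $\Gamma\vdash A:\mathrm{Type}$, then $\Gamma,x:A\vdash$ and $\Gamma,i:A\vdash$. - If $\Gamma\vdash$, then $\Gamma\vdash\mathrm{Type}:\mathrm{Kind}$, every entry $x:A$ or $i:A$ of $\Gamma$ gives $\Gamma\vdash x:A$ or $\Gamma\vdash i:A$, and every global or local constant $c$ of declared type $A$ gives $\Gamma\vdash c:A$. - If $\Gamma\vdash$, then $\Gamma\vdash 0:\mathsf{Lvl}$. If $\Gamma\vdash l:\mathsf{Lvl}$ and $\Gamma\vdash l':\mathsf{Lvl}$, then $\Gamma\vdash\mathsf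 S\,l:\mathsf{Lvl}$ and $\Gamma\vdash l\sqcup l':\mathsf{Lvl}$. - If $A\equiv B$: $\Gamma\vdash t:A$ and $\Gamma\vdash B:s$ give $\Gamma\vdash t:B$; and $\Gamma\vdash l:A$ and $\Gamma\vdash B:\mathrm{Type}$ give $\Gamma\vdash l:B$. - If $\Gamma\vdash A:\mathrm{Type}$ and $\Gamma,x:A\vdash B:s$, then $\Gamma\vdash(x:A)\to B:s$, and if moreover $\Gamma,x:A\vdash t:B$ then $\Gamma\vdash x.t:(x:A)\to B$. The same two rules hold with a confined variable $i$ instead of $x$. - $\Gamma\vdash t:(x:A)\to B$ and $\Gamma\vdash u:A$ give $\Gamma\vdash t\,u:B[x\mapsto u]$; $\Gamma\vdash t:(i:A)\to B$ and $\Gamma\vdash l:A$ give $\Gamma\vdash t\,l:B[i\mapsto l]$. $\Phi'$ is *well-formed in $\mathbb{UPP}$* if, for each entry $c:A$ (resp. $c:A:=t$), $\cdot\vdash A:s$ for some sort $s$ (resp. $\cdot\vdash t:A$) is derivable using only the local entries that precede it. **Typing under constraints.** Reserve infinitely many confined variables, the *level variables*, which are neither bound in terms nor declared in the contexts $\Gamma$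 below, and fix a finite set $V$ of them (the ones inserted in the terms to elaborate). A *constraint* is a pair $l\doteq l'$ of levels. A *level substitution* $\theta$ is a substitution with finite domain that maps level variables to levels over level variables; $\theta\vDash\mathcal C$ means $l[\theta]\simeq l'[\theta]$ for all $l\doteq l'\in\mathcal C$. Let $\Xi_\theta$ be the context with an entry $j:\mathsf{Lvl}$ for each variable $j$ that occurs in $i[\theta]$ for some $i\in V$. Write $\Gamma\vdash_{\mathcal C}$ if $\Xi_\theta,\Gamma[\theta]\vdash$ for every $\theta\vDash\mathcal C$, and $\Gamma\vdash_{\mathcal C}t:A$ if $\Xi_\theta,\Gamma[\theta]\vdash t[\theta]:A[\theta]$ for every $\theta\vDash\mathcal C$. **The bidirectional system.** Write $t\longrightarrow^{\mathrm{wh}}u$ if $t\longrightarrow^*u$ and, whenever $u\longrightarrow^*u'\,a_1\dots a_k$ ($k\ge0$, each $a_m$ a term or a level), $u'$ is not an instance of the left-hand side of a rule of $\longrightarrow$. Constrained conversion is inductively defined as follows. - If $A\longrightarrow^{\mathrm{wh}}A'$, $B\longrightarrow^{\mathrm{wh}}B'$ and $A'\equiv_{\mathrm{whnf}}B'\downarrow\mathcal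 C$, then $A\equiv B\downarrow\mathcal C$. - $t\equiv_{\mathrm{whnf}}t\downarrow\emptyset$ if $t$ is a variable $x$, a constant or a sort. - $t\equiv t'\downarrow\mathcal C$ gives $x.t\equiv_{\mathrm{whnf}}x.t'\downarrow\mathcal C$. - $A\equiv A'\downarrow\mathcal C_1$ and $B\equiv B'\downarrow\mathcal C_2$ give $(x:A)\to B\equiv_{\mathrm{whnf}}(x:A')\to B'\downarrow\mathcal C_1\cup\mathcal C_2$. - $t\equiv_{\mathrm{whnf}}t'\downarrow\mathcal C_1$ and $u\equiv u'\downarrow\mathcal C_2$ give $t\,u\equiv_{\mathrm{whnf}}t'\,u'\downarrow\mathcal C_1\cup\mathcal C_2$. - $t\equiv_{\mathrm{whnf}}t'\downarrow\mathcal C$ gives $t\,l\equiv_{\mathrm{whnf}}t'\,l'\downarrow\mathcal C\cup\{l\doteq l'\}$. The judgments *check* $\Gamma\uparrow\mathcal D\vdash t\Leftarrow A\downarrow\mathcal C$ and *infer* $\Gamma\uparrow\mathcal D\vdash t\Rightarrow A\downarrow\mathcal C$ are inductively defined as follows. - (Switch) $\Gamma\uparrow\mathcal D\vdash t\Rightarrow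 A\downarrow\mathcal C_1$ and $A\equiv B\downarrow\mathcal C_2$ give $\Gamma\uparrow\mathcal D\vdash t\Leftarrow B\downarrow\mathcal C_1\cup\mathcal C_2$. - (Abs) $C\longrightarrow^{\mathrm{wh}}(x:A)\to B$ and $\Gamma,x:A\uparrow\mathcal D\vdash t\Leftarrow B\downarrow\mathcal C$ give $\Gamma\uparrow\mathcal D\vdash x.t\Leftarrow C\downarrow\mathcal C$. - (Var) $x:A\in\Gamma$ gives $\Gamma\uparrow\mathcal D\vdash x\Rightarrow A\downarrow\emptyset$. - (Cons) If the constant $c$ has declared type $(j_1\dots j_k:\mathsf{Lvl})\to B$ and $i_1,\dots,i_k$ are level variables, then $\Gamma\uparrow\mathcal D\vdash c\,i_1\dots i_k\Rightarrow B[\vec j\mapsto\vec i]\downarrow\emptyset$. - (Sort) $\Gamma\uparrow\mathcal D\vdash\mathrm{Type}\Rightarrow\mathrm{Kind}\downarrow\emptyset$. - (Pi) $\Gamma\uparrow\mathcal D\vdash A\Leftarrow\mathrm{Type}\downarrow\mathcal C_1$, $\Gamma,x:A\uparrow\mathcal D\cup\mathcal C_1\vdash B\Rightarrow C\downarrow\mathcal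 C_2$ and $C\longrightarrow^{\mathrm{wh}}s$ give $\Gamma\uparrow\mathcal D\vdash(x:A)\to B\Rightarrow s\downarrow\mathcal C_1\cup\mathcal C_2$. - (App) $\Gamma\uparrow\mathcal D\vdash t\Rightarrow C\downarrow\mathcal C_1$, $C\longrightarrow^{\mathrm{wh}}(x:A)\to B$ and $\Gamma\uparrow\mathcal D\cup\mathcal C_1\vdash u\Leftarrow A\downarrow\mathcal C_2$ give $\Gamma\uparrow\mathcal D\vdash t\,u\Rightarrow B[x\mapsto u]\downarrow\mathcal C_1\cup\mathcal C_2$. **Theorem (soundness of the type system for computing constraints).** Let $\Phi'$ be a local signature that is well-formed in $\mathbb{UPP}$, let $\mathcal C,\mathcal D$ be sets of constraints, and let $t$ be a term whose free level variables all belong to $V$. Then, for every context $\Gamma$ and term $A$: - if $\Gamma\vdash_{\mathcal D}A:s$ for a sort $s$ and $\Gamma\uparrow\mathcal D\vdash t\Leftarrow A\downarrow\mathcal C$, then $\Gamma\vdash_{\mathcal C\cup\mathcal D}t:A$; - if $\Gamma\vdash_{\mathcal D}$ and $\Gamma\uparrow\mathcal D\vdash t\Rightarrow A\downarrow\mathcal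 C$, then $\Gamma\vdash_{\mathcal C\cup\mathcal D}t:A$. -/

import Mathlib

/-! Dedukti with confinement, instantiated at the universe-polymorphic predicative theory `UPP`
extended by a local signature, and the bidirectional system that computes level constraints.

Bound variables and context variables are de Bruijn indices, with separate index spaces for regular
variables `x` and confined variables `i`.  Free level variables (the ones inserted in schematic
terms, on which level substitutions act) are called by their name, a natural number. -/

namespace UPP

/-- The confined terms of `UPP`.  A confined variable is either a free level variable `name i`, or
the de Bruijn index `idx n` of a variable bound by `i. t`, by `(i : A) → B` or by a context entry
`i : A`. -/
inductive Level : Type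
  | name (i : ℕ)
  | idx (n : ℕ)
  | zero
  | succ (l : Level)
  | sup (l l' : Level)

/-- The global constants of `UPP`. -/
inductive Glob : Type
  | Lvl | Ty | Tm | U | Pi | Lam | App

/-- A (non-confined) constant is a global one, or a local one given by its name. -/
inductive Const : Type
  | glob (g : Glob)
  | loc (c : ℕ)

/-- The sorts of Dedukti. -/
inductive Srt : Type
  | type | kind

/-- The terms of Dedukti. -/
inductive Term : Type
  /-- A regular variable `x`. -/
  | var (n : ℕ)
  /-- A constant `c`. -/
  | const (c : Const)
  /-- A sort `s`. -/
  | sort (s : Srt)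
  /-- `(x : A) → B`. -/
  | pi (A B : Term)
  /-- `x. t`. -/
  | lam (t : Term)
  /-- `t u`. -/
  | app (t u : Term)
  /-- `(i : A) → B`. -/
  | piC (A B : Term)
  /-- `i. t`. -/
  | lamC (t : Term)
  /-- `t l`. -/
  | appC (t : Term) (l : Level)

/-! ### Renaming and substitution of de Bruijn indices -/

/-- Renaming of the confined indices of a level. -/
def Level.rename (ξ : ℕ → ℕ) : Level → Level
  | name i => name i
  | idx n => idx (ξ n)
  | zero => zero
  | succ l => succ (l.rename ξ)
  | sup l l' => sup (l.rename ξ) (l'.rename ξ)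

/-- Substitution of the confined indices of a level. -/
def Level.subst (τ : ℕ → Level) : Level → Level
  | name i => name i
  | idx n => τ n
  | zero => zero
  | succ l => succ (l.subst τ)
  | sup l l' => sup (l.subst τ) (l'.subst τ)

/-- The extension of a renaming under a binder of its index space. -/
def upRen (ρ : ℕ → ℕ) : ℕ → ℕ
  | 0 => 0
  | n + 1 => ρ n + 1

/-- Renaming of the regular indices (by `ρ`) and the confined indices (by `ξ`) of a term. -/
def Term.rename : (ρ ξ : ℕ → ℕ) → Term → Term
  | ρ, _, var n => var (ρ n)
  | _, _, const c => const c
  | _, _, sort s => sort s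
  | ρ, ξ, pi A B => pi (A.rename ρ ξ) (B.rename (upRen ρ) ξ)
  | ρ, ξ, lam t => lam (t.rename (upRen ρ) ξ)
  | ρ, ξ, app t u => app (t.rename ρ ξ) (u.rename ρ ξ)
  | ρ, ξ, piC A B => piC (A.rename ρ ξ) (B.rename ρ (upRen ξ))
  | ρ, ξ, lamC t => lamC (t.rename ρ (upRen ξ))
  | ρ, ξ, appC t l => appC (t.rename ρ ξ) (l.rename ξ)

/-- Shift under a new regular variable. -/
def Term.shift (t : Term) : Term := t.rename Nat.succ id

/-- Shift under a new confined variable. -/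
def Term.shiftC (t : Term) : Term := t.rename id Nat.succ

/-- The extension of a substitution of regular variables under a regular binder. -/
def upSub (σ : ℕ → Term) : ℕ → Term
  | 0 => .var 0
  | n + 1 => (σ n).shift

/-- The extension of a substitution of confined variables under a confined binder. -/
def upSubC (τ : ℕ → Level) : ℕ → Level
  | 0 => .idx 0
  | n + 1 => (τ n).rename Nat.succ

/-- Simultaneous substitution of the regular indices (by `σ`) and the confined indices (by `τ`). -/
def Term.subst : (σ : ℕ → Term) → (τ : ℕ → Level) → Term → Term
  | σ, _, var n => σ n
  | _, _, const c => const c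
  | _, _, sort s => sort s
  | σ, τ, pi A B => pi (A.subst σ τ) (B.subst (upSub σ) τ)
  | σ, τ, lam t => lam (t.subst (upSub σ) τ)
  | σ, τ, app t u => app (t.subst σ τ) (u.subst σ τ)
  | σ, τ, piC A B => piC (A.subst σ τ) (B.subst (fun n => (σ n).shiftC) (upSubC τ))
  | σ, τ, lamC t => lamC (t.subst (fun n => (σ n).shiftC) (upSubC τ))
  | σ, τ, appC t l => appC (t.subst σ τ) (l.subst τ)

/-- `B[x ↦ u]`, where `x` is the last regular variable of the scope of `B`. -/
def Term.inst (B u : Term) : Term :=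
  B.subst (fun n => match n with | 0 => u | n + 1 => .var n) .idx

/-- `B[i ↦ l]`, where `i` is the last confined variable of the scope of `B`. -/
def Term.instC (B : Term) (l : Level) : Term :=
  B.subst .var (fun n => match n with | 0 => l | n + 1 => .idx n)

/-! ### Free level variables and level substitutions -/

/-- The free level variables of a level. -/
def Level.names : Level → Finset ℕ
  | name i => {i}
  | idx _ => ∅
  | zero => ∅
  | succ l => l.names
  | sup l l' => l.names ∪ l'.names

/-- The free level variables of a term. -/
def Term.names : Term → Finset ℕ
  | var _ => ∅
  | const _ => ∅
  | sort _ => ∅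
  | pi A B => A.names ∪ B.names
  | lam t => t.names
  | app t u => t.names ∪ u.names
  | piC A B => A.names ∪ B.names
  | lamC t => t.names
  | appC t l => t.names ∪ l.names

/-- The level has no de Bruijn index: all its variables are free level variables. -/
def Level.IdxFree : Level → Prop
  | name _ => True
  | idx _ => False
  | zero => True
  | succ l => l.IdxFree
  | sup l l' => l.IdxFree ∧ l'.IdxFree

/-- A level substitution `θ`: a substitution with finite domain, mapping free level variables to
levels over free level variables. -/
structure LevelSubst : Type where
  toFun : ℕ → Level
  finite : {i | toFun i ≠ .name i}.Finite
  idxFree : ∀ i, (toFun i).IdxFree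

/-- `l[θ]`. -/
def Level.lsubst (θ : LevelSubst) : Level → Level
  | name i => θ.toFun i
  | idx n => idx n
  | zero => zero
  | succ l => succ (l.lsubst θ)
  | sup l l' => sup (l.lsubst θ) (l'.lsubst θ)

/-- `t[θ]`.  No shift is needed under binders, since the levels `θ i` contain no index. -/
def Term.lsubst (θ : LevelSubst) : Term → Term
  | var n => var n
  | const c => const c
  | sort s => sort s
  | pi A B => pi (A.lsubst θ) (B.lsubst θ)
  | lam t => lam (t.lsubst θ)
  | app t u => app (t.lsubst θ) (u.lsubst θ)
  | piC A B => piC (A.lsubst θ) (B.lsubst θ)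
  | lamC t => lamC (t.lsubst θ)
  | appC t l => appC (t.lsubst θ) (l.lsubst θ)

/-! ### The theory `UPP` and local signatures -/

/-- The type of levels. -/
def tLvl : Term := .const (.glob .Lvl)

/-- `Ty l`. -/
def tTy (l : Level) : Term := .appC (.const (.glob .Ty)) l

/-- `Tm l A`. -/
def tTm (l : Level) (A : Term) : Term := .app (.appC (.const (.glob .Tm)) l) A

/-- `U l`. -/
def tU (l : Level) : Term := .appC (.const (.glob .U)) l

/-- `Π l l' A B`. -/
def tPi (l l' : Level) (A B : Term) : Term :=
  .app (.app (.appC (.appC (.const (.glob .Pi)) l) l') A) B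

/-- `λ l l' A B t`. -/
def tLam (l l' : Level) (A B t : Term) : Term :=
  .app (.app (.app (.appC (.appC (.const (.glob .Lam)) l) l') A) B) t

/-- `@ l l' A B t u`. -/
def tApp (l l' : Level) (A B t u : Term) : Term :=
  .app (.app (.app (.app (.appC (.appC (.const (.glob .App)) l) l') A) B) t) u

/-- The types of the global constants. -/
def Glob.type : Glob → Term
  -- `Lvl : Type`
  | Lvl => .sort .type
  -- `Ty : (l : Lvl) → Type`
  | Ty => .piC tLvl (.sort .type)
  -- `Tm : (l : Lvl) → Ty l → Type`
  | Tm => .piC tLvl (.pi (tTy (.idx 0)) (.sort .type))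
  -- `U : (l : Lvl) → Ty (S l)`
  | U => .piC tLvl (tTy (.succ (.idx 0)))
  -- `Π : (l l' : Lvl) → (A : Ty l) → (B : Tm l A → Ty l') → Ty (l ⊔ l')`
  | Pi => .piC tLvl (.piC tLvl (.pi (tTy (.idx 1))
      (.pi (.pi (tTm (.idx 1) (.var 0)) (tTy (.idx 0)))
        (tTy (.sup (.idx 1) (.idx 0))))))
  -- `λ : (l l' : Lvl) → (A : Ty l) → (B : Tm l A → Ty l') →`
  -- `  ((x : Tm l A) → Tm l' (B x)) → Tm (l ⊔ l') (Π l l' A B)`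
  | Lam => .piC tLvl (.piC tLvl (.pi (tTy (.idx 1))
      (.pi (.pi (tTm (.idx 1) (.var 0)) (tTy (.idx 0)))
        (.pi (.pi (tTm (.idx 1) (.var 1)) (tTm (.idx 0) (.app (.var 1) (.var 0))))
          (tTm (.sup (.idx 1) (.idx 0)) (tPi (.idx 1) (.idx 0) (.var 2) (.var 1)))))))
  -- `@ : (l l' : Lvl) → (A : Ty l) → (B : Tm l A → Ty l') →`
  -- `  (t : Tm (l ⊔ l') (Π l l' A B)) → (u : Tm l A) → Tm l' (B u)`
  | App => .piC tLvl (.piC tLvl (.pi (tTy (.idx 1))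
      (.pi (.pi (tTm (.idx 1) (.var 0)) (tTy (.idx 0)))
        (.pi (tTm (.sup (.idx 1) (.idx 0)) (tPi (.idx 1) (.idx 0) (.var 1) (.var 0)))
          (.pi (tTm (.idx 1) (.var 2))
            (tTm (.idx 0) (.app (.var 2) (.var 0))))))))

/-- An entry `c : A` (no body) or `c : A := t` of a local signature. -/
structure SigEntry : Type where
  name : ℕ
  type : Term
  body : Option Term

/-- A local signature, the most recent entry first. -/
abbrev LocalSig : Type := List SigEntry

/-- `c : A` or `c : A := t` is an entry of the signature of `UPP` extended by `Φ`. -/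
inductive Declares (Φ : LocalSig) : Const → Term → Prop
  | glob (g : Glob) : Declares Φ (.glob g) g.type
  | loc {e : SigEntry} : e ∈ Φ → Declares Φ (.loc e.name) e.type

/-! ### Rewriting and conversion -/

/-- The equational theory of levels: the congruence generated by the substitution instances of the
equations of `UPP`. -/
inductive LevelEq : Level → Level → Prop
  | refl (l) : LevelEq l l
  | symm {l l'} : LevelEq l l' → LevelEq l' l
  | trans {l l' l''} : LevelEq l l' → LevelEq l' l'' → LevelEq l l''
  | succ_congr {l l'} : LevelEq l l' → LevelEq (.succ l) (.succ l')
  | sup_congr {l₁ l₁' l₂ l₂'} : LevelEq l₁ l₁' → LevelEq l₂ l₂' →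
      LevelEq (.sup l₁ l₂) (.sup l₁' l₂')
  | assoc (l₁ l₂ l₃) : LevelEq (.sup l₁ (.sup l₂ l₃)) (.sup (.sup l₁ l₂) l₃)
  | comm (l₁ l₂) : LevelEq (.sup l₁ l₂) (.sup l₂ l₁)
  | succ_sup (l₁ l₂) : LevelEq (.succ (.sup l₁ l₂)) (.sup (.succ l₁) (.succ l₂))
  | sup_succ (l) : LevelEq (.sup l (.succ l)) (.succ l)
  | sup_zero (l) : LevelEq (.sup l .zero) l
  | sup_idem (l) : LevelEq (.sup l l) l

/-- The relation `≃` on terms: the two terms are equal up to the equational theory of the levels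
that occur in them. -/
inductive TermEq : Term → Term → Prop
  | var (n) : TermEq (.var n) (.var n)
  | const (c) : TermEq (.const c) (.const c)
  | sort (s) : TermEq (.sort s) (.sort s)
  | pi {A A' B B'} : TermEq A A' → TermEq B B' → TermEq (.pi A B) (.pi A' B')
  | lam {t t'} : TermEq t t' → TermEq (.lam t) (.lam t')
  | app {t t' u u'} : TermEq t t' → TermEq u u' → TermEq (.app t u) (.app t' u')
  | piC {A A' B B'} : TermEq A A' → TermEq B B' → TermEq (.piC A B) (.piC A' B')
  | lamC {t t'} : TermEq t t' → TermEq (.lamC t) (.lamC t')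
  | appC {t t' l l'} : TermEq t t' → LevelEq l l' → TermEq (.appC t l) (.appC t' l')

/-- `Contracts Φ u v`: the term `u` is an instance of the left-hand side of a rule among `β`, `βc`,
the `δ` rules of `Φ` and the rewrite rules of `UPP`, and `v` is the corresponding instance of its
right-hand side. -/
inductive Contracts (Φ : LocalSig) : Term → Term → Prop
  | beta (t u) : Contracts Φ (.app (.lam t) u) (t.inst u)
  | betaC (t l) : Contracts Φ (.appC (.lamC t) l) (t.instC l)
  | delta {e : SigEntry} {t : Term} : e ∈ Φ → e.body = some t →
      Contracts Φ (.const (.loc e.name)) t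
  | tmU (l' l) : Contracts Φ (tTm l' (tU l)) (tTy l)
  | appLam (l l' l'' l''' A B A' B' t u) :
      Contracts Φ (tApp l l' A B (tLam l'' l''' A' B' t) u) (.app t u)

/-- One-step reduction `⟶`: the closure by context of `Contracts Φ`. -/
inductive Step (Φ : LocalSig) : Term → Term → Prop
  | root {t t'} : Contracts Φ t t' → Step Φ t t'
  | pi_dom {A A'} (B) : Step Φ A A' → Step Φ (.pi A B) (.pi A' B)
  | pi_cod {B B'} (A) : Step Φ B B' → Step Φ (.pi A B) (.pi A B')
  | lam {t t'} : Step Φ t t' → Step Φ (.lam t) (.lam t')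
  | app_fun {t t'} (u) : Step Φ t t' → Step Φ (.app t u) (.app t' u)
  | app_arg {u u'} (t) : Step Φ u u' → Step Φ (.app t u) (.app t u')
  | piC_dom {A A'} (B) : Step Φ A A' → Step Φ (.piC A B) (.piC A' B)
  | piC_cod {B B'} (A) : Step Φ B B' → Step Φ (.piC A B) (.piC A B')
  | lamC {t t'} : Step Φ t t' → Step Φ (.lamC t) (.lamC t')
  | appC {t t'} (l) : Step Φ t t' → Step Φ (.appC t l) (.appC t' l)

/-- Reduction in any number of steps. -/
def Red (Φ : LocalSig) : Term → Term → Prop := Relation.ReflTransGen (Step Φ)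

/-- Conversion `≡`: the equivalence relation generated by `⟶` and `≃`. -/
def Conv (Φ : LocalSig) : Term → Term → Prop :=
  Relation.EqvGen (fun t u => Step Φ t u ∨ TermEq t u)

/-! ### Typing -/

/-- A context entry: `reg A` stands for `x : A` and `conf A` for `i : A`. -/
inductive CtxEntry : Type
  | reg (A : Term)
  | conf (A : Term)

/-- Contexts, the most recent entry first. -/
abbrev Ctx : Type := List CtxEntry

/-- `x : A ∈ Γ`, where `x` is the regular variable of index `n`. -/
inductive Ctx.HasVar : Ctx → ℕ → Term → Prop
  | here (Γ A) : HasVar (.reg A :: Γ) 0 A.shift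
  | reg {Γ n A} (B) : HasVar Γ n A → HasVar (.reg B :: Γ) (n + 1) A.shift
  | conf {Γ n A} (B) : HasVar Γ n A → HasVar (.conf B :: Γ) n A.shiftC

/-- `i : A ∈ Γ`, where `i` is the confined variable of index `n`. -/
inductive Ctx.HasVarC : Ctx → ℕ → Term → Prop
  | here (Γ A) : HasVarC (.conf A :: Γ) 0 A.shiftC
  | reg {Γ n A} (B) : HasVarC Γ n A → HasVarC (.reg B :: Γ) n A.shift
  | conf {Γ n A} (B) : HasVarC Γ n A → HasVarC (.conf B :: Γ) (n + 1) A.shiftC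

/-- `Γ[θ]`. -/
def Ctx.lsubst (θ : LevelSubst) : Ctx → Ctx
  | [] => []
  | .reg A :: Γ => .reg (A.lsubst θ) :: Ctx.lsubst θ Γ
  | .conf A :: Γ => .conf (A.lsubst θ) :: Ctx.lsubst θ Γ

/-- The judgment forms `Γ ⊢`, `Γ ⊢ t : A` and `Γ ⊢ l : A`. -/
inductive Judgment : Type
  | wf
  | term (t A : Term)
  | level (l : Level) (A : Term)

/-- `Der Φ Ξ Γ J` is the Dedukti judgment `Ξ, Γ ⊢ J` in the theory `UPP` extended by `Φ`, where the
finite set `Ξ` stands for the context with an entry `j : Lvl` for every `j ∈ Ξ`. -/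
inductive Der (Φ : LocalSig) (Ξ : Finset ℕ) : Ctx → Judgment → Prop
  | emptyCtx : Der Φ Ξ [] .wf
  | extCtx {Γ A} : Der Φ Ξ Γ (.term A (.sort .type)) → Der Φ Ξ (.reg A :: Γ) .wf
  | extCtxC {Γ A} : Der Φ Ξ Γ (.term A (.sort .type)) → Der Φ Ξ (.conf A :: Γ) .wf
  | sort {Γ} : Der Φ Ξ Γ .wf → Der Φ Ξ Γ (.term (.sort .type) (.sort .kind))
  | var {Γ n A} : Ctx.HasVar Γ n A → Der Φ Ξ Γ .wf → Der Φ Ξ Γ (.term (.var n) A)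
  -- the confined variables of `Γ`
  | varC {Γ n A} : Ctx.HasVarC Γ n A → Der Φ Ξ Γ .wf → Der Φ Ξ Γ (.level (.idx n) A)
  -- the confined variables of `Ξ`
  | varΞ {Γ j} : j ∈ Ξ → Der Φ Ξ Γ .wf → Der Φ Ξ Γ (.level (.name j) tLvl)
  | cons {Γ c A} : Declares Φ c A → Der Φ Ξ Γ .wf → Der Φ Ξ Γ (.term (.const c) A)
  -- the rule for confined constants, for `0 : () → Lvl`, `S : (i : Lvl) → Lvl` and
  -- `⊔ : (i : Lvl, i' : Lvl) → Lvl`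
  | zero {Γ} : Der Φ Ξ Γ .wf → Der Φ Ξ Γ (.level .zero tLvl)
  | succ {Γ l} : Der Φ Ξ Γ (.level l tLvl) → Der Φ Ξ Γ (.level (.succ l) tLvl)
  | sup {Γ l l'} : Der Φ Ξ Γ (.level l tLvl) → Der Φ Ξ Γ (.level l' tLvl) →
      Der Φ Ξ Γ (.level (.sup l l') tLvl)
  | conv {Γ t A B s} : Conv Φ A B → Der Φ Ξ Γ (.term t A) → Der Φ Ξ Γ (.term B (.sort s)) →
      Der Φ Ξ Γ (.term t B)
  | convC {Γ l A B} : Conv Φ A B → Der Φ Ξ Γ (.level l A) →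
      Der Φ Ξ Γ (.term B (.sort .type)) → Der Φ Ξ Γ (.level l B)
  | arrow {Γ A B s} : Der Φ Ξ Γ (.term A (.sort .type)) →
      Der Φ Ξ (.reg A :: Γ) (.term B (.sort s)) → Der Φ Ξ Γ (.term (.pi A B) (.sort s))
  | arrowC {Γ A B s} : Der Φ Ξ Γ (.term A (.sort .type)) →
      Der Φ Ξ (.conf A :: Γ) (.term B (.sort s)) → Der Φ Ξ Γ (.term (.piC A B) (.sort s))
  | abs {Γ A B t s} : Der Φ Ξ Γ (.term A (.sort .type)) →
      Der Φ Ξ (.reg A :: Γ) (.term B (.sort s)) → Der Φ Ξ (.reg A :: Γ) (.term t B) →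
      Der Φ Ξ Γ (.term (.lam t) (.pi A B))
  | absC {Γ A B t s} : Der Φ Ξ Γ (.term A (.sort .type)) →
      Der Φ Ξ (.conf A :: Γ) (.term B (.sort s)) → Der Φ Ξ (.conf A :: Γ) (.term t B) →
      Der Φ Ξ Γ (.term (.lamC t) (.piC A B))
  | app {Γ t u A B} : Der Φ Ξ Γ (.term t (.pi A B)) → Der Φ Ξ Γ (.term u A) →
      Der Φ Ξ Γ (.term (.app t u) (B.inst u))
  | appC {Γ t l A B} : Der Φ Ξ Γ (.term t (.piC A B)) → Der Φ Ξ Γ (.level l A) →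
      Der Φ Ξ Γ (.term (.appC t l) (B.instC l))

/-- `Φ` is well-formed in `UPP`: every entry declares a new constant and is valid in the theory
`UPP` extended by the preceding entries. -/
inductive LocalSig.WellFormed : LocalSig → Prop
  | nil : WellFormed []
  | decl {Φ : LocalSig} {c : ℕ} {A : Term} {s : Srt} : WellFormed Φ → (∀ e ∈ Φ, e.name ≠ c) →
      Der Φ ∅ [] (.term A (.sort s)) → WellFormed (⟨c, A, none⟩ :: Φ)
  | defn {Φ : LocalSig} {c : ℕ} {A t : Term} : WellFormed Φ → (∀ e ∈ Φ, e.name ≠ c) →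
      Der Φ ∅ [] (.term t A) → WellFormed (⟨c, A, some t⟩ :: Φ)

/-! ### Constraints and typing under constraints -/

/-- A level constraint, i.e. an equation `l ≐ l'` between levels. -/
abbrev Constraint : Type := Level × Level

/-- `θ ⊨ C`. -/
def LevelSubst.Satisfies (θ : LevelSubst) (C : Set Constraint) : Prop :=
  ∀ e ∈ C, LevelEq (e.1.lsubst θ) (e.2.lsubst θ)

/-- The context `Ξ_θ`, where `V` is the set of the level variables inserted in the schematic terms:
it has an entry `j : Lvl` for every level variable `j` that occurs in `i[θ]` for some `i ∈ V`. -/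
def levelCtx (V : Finset ℕ) (θ : LevelSubst) : Finset ℕ :=
  V.biUnion fun i => (θ.toFun i).names

/-- `Γ ⊢_C`. -/
def WfUnder (Φ : LocalSig) (V : Finset ℕ) (C : Set Constraint) (Γ : Ctx) : Prop :=
  ∀ θ : LevelSubst, θ.Satisfies C → Der Φ (levelCtx V θ) (Γ.lsubst θ) .wf

/-- `Γ ⊢_C t : A`. -/
def TypedUnder (Φ : LocalSig) (V : Finset ℕ) (C : Set Constraint) (Γ : Ctx) (t A : Term) : Prop :=
  ∀ θ : LevelSubst, θ.Satisfies C →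
    Der Φ (levelCtx V θ) (Γ.lsubst θ) (.term (t.lsubst θ) (A.lsubst θ))

/-! ### The bidirectional system -/

/-- An argument of an application: a regular or a confined term. -/
inductive Arg : Type
  | reg (u : Term)
  | conf (l : Level)

/-- `t a₁ … aₖ`. -/
def Term.appArgs : Term → List Arg → Term
  | t, [] => t
  | t, .reg u :: as => (Term.app t u).appArgs as
  | t, .conf l :: as => (Term.appC t l).appArgs as

/-- Weak-head normal forms: if `u` reduces to `u' a₁ … aₖ`, then `u'` is not an instance of the
left-hand side of a rule. -/
def IsWhnf (Φ : LocalSig) (u : Term) : Prop :=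
  ∀ u' as, Red Φ u (Term.appArgs u' as) → ¬ ∃ v, Contracts Φ u' v

/-- `t ⟶ʷʰ u`: the term `t` reduces to the weak-head normal form `u`. -/
def RedWh (Φ : LocalSig) (t u : Term) : Prop := Red Φ t u ∧ IsWhnf Φ u

/-- The two constrained conversion judgments `A ≡ B ↓ C` and `A ≡_whnf B ↓ C`. -/
inductive ConvMode : Type
  | any | whnf

/-- The rules of the constrained conversion judgments. -/
inductive ConvC (Φ : LocalSig) : ConvMode → Term → Term → Set Constraint → Prop
  | reduce {A A' B B' C} : RedWh Φ A A' → RedWh Φ B B' → ConvC Φ .whnf A' B' C →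
      ConvC Φ .any A B C
  | var (n) : ConvC Φ .whnf (.var n) (.var n) ∅
  | const (c) : ConvC Φ .whnf (.const c) (.const c) ∅
  | sort (s) : ConvC Φ .whnf (.sort s) (.sort s) ∅
  | lam {t t' C} : ConvC Φ .any t t' C → ConvC Φ .whnf (.lam t) (.lam t') C
  | pi {A A' B B' C₁ C₂} : ConvC Φ .any A A' C₁ → ConvC Φ .any B B' C₂ →
      ConvC Φ .whnf (.pi A B) (.pi A' B') (C₁ ∪ C₂)
  | app {t t' u u' C₁ C₂} : ConvC Φ .whnf t t' C₁ → ConvC Φ .any u u' C₂ →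
      ConvC Φ .whnf (.app t u) (.app t' u') (C₁ ∪ C₂)
  | appC {t t' C} (l l') : ConvC Φ .whnf t t' C →
      ConvC Φ .whnf (.appC t l) (.appC t' l') (C ∪ {(l, l')})

/-- `(j₁ … jₖ : Lvl) → B`. -/
def piLvls : ℕ → Term → Term
  | 0, B => B
  | k + 1, B => .piC tLvl (piLvls k B)

/-- `t i₁ … iₖ` for free level variables `i₁, …, iₖ`. -/
def Term.appNames (t : Term) (is : List ℕ) : Term :=
  is.foldl (fun t i => .appC t (.name i)) t

/-- `B[j₁ ↦ i₁, …, jₖ ↦ iₖ]`, where `j₁, …, jₖ` are the last confined variables of the scope of `B`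
(`jₖ` being the last one) and `i₁, …, iₖ` are free level variables. -/
def Term.instNames (B : Term) (is : List ℕ) : Term :=
  is.foldr (fun i B => B.instC (.name i)) B

/-- The two modes of the bidirectional system. -/
inductive Mode : Type
  | check | infer

/-- The bidirectional system: `Bidi Φ .check Γ D t A C` is `Γ ↑ D ⊢ t ⇐ A ↓ C`, and
`Bidi Φ .infer Γ D t A C` is `Γ ↑ D ⊢ t ⇒ A ↓ C`. -/
inductive Bidi (Φ : LocalSig) :
    Mode → Ctx → Set Constraint → Term → Term → Set Constraint → Prop
  | switch {Γ D t A B C₁ C₂} : Bidi Φ .infer Γ D t A C₁ → ConvC Φ .any A B C₂ →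
      Bidi Φ .check Γ D t B (C₁ ∪ C₂)
  | abs {Γ D t A B T C} : RedWh Φ T (.pi A B) → Bidi Φ .check (.reg A :: Γ) D t B C →
      Bidi Φ .check Γ D (.lam t) T C
  | var {Γ n A} (D) : Ctx.HasVar Γ n A → Bidi Φ .infer Γ D (.var n) A ∅
  | cons {c B} (Γ D) (is : List ℕ) : Declares Φ c (piLvls is.length B) →
      Bidi Φ .infer Γ D (Term.appNames (.const c) is) (B.instNames is) ∅
  | sort (Γ D) : Bidi Φ .infer Γ D (.sort .type) (.sort .kind) ∅
  | pi {Γ D A B T s C₁ C₂} : Bidi Φ .check Γ D A (.sort .type) C₁ →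
      Bidi Φ .infer (.reg A :: Γ) (D ∪ C₁) B T C₂ → RedWh Φ T (.sort s) →
      Bidi Φ .infer Γ D (.pi A B) (.sort s) (C₁ ∪ C₂)
  | app {Γ D t u T A B C₁ C₂} : Bidi Φ .infer Γ D t T C₁ → RedWh Φ T (.pi A B) →
      Bidi Φ .check Γ (D ∪ C₁) u A C₂ →
      Bidi Φ .infer Γ D (.app t u) (B.inst u) (C₁ ∪ C₂)

end UPP

/-!
Parallel reduction, taken modulo the level equations, contracts `(x. t) u` and the other redexes
simultaneously with the reduction of their subterms.  Every term has a complete development, to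
which all its parallel reducts reduce up to the level equations; so parallel reduction is confluent,
`≡` is joinability, and products and the types `Tm l (Π l l' A B)` are injective for `≡`.
Injectivity turns inversion of typing derivations into subject reduction.

A level substitution `θ` that satisfies the computed constraints turns constrained conversion into
`≡`, and commutes with reduction because the bodies of the constants are closed.  By induction, it
then turns a bidirectional derivation into a typing derivation: subject reduction types the
weak-head normal forms that the bidirectional rules expose.
-/

namespace UPP

/-! ### The substitution calculus -/

namespace Level

theorem rename_rename (ρ ρ' : ℕ → ℕ) (l : Level) :
    (l.rename ρ).rename ρ' = l.rename (fun n => ρ' (ρ n)) := by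
  induction l <;> simp_all [rename]

theorem subst_rename (ρ : ℕ → ℕ) (τ : ℕ → Level) (l : Level) :
    (l.rename ρ).subst τ = l.subst (fun n => τ (ρ n)) := by
  induction l <;> simp_all [rename, subst]

theorem rename_subst (τ : ℕ → Level) (ρ : ℕ → ℕ) (l : Level) :
    (l.subst τ).rename ρ = l.subst (fun n => (τ n).rename ρ) := by
  induction l <;> simp_all [rename, subst]

theorem subst_subst (τ τ' : ℕ → Level) (l : Level) :
    (l.subst τ).subst τ' = l.subst (fun n => (τ n).subst τ') := by
  induction l <;> simp_all [subst]

theorem subst_idx (l : Level) : l.subst idx = l := by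
  induction l <;> simp_all [subst]

theorem rename_id (l : Level) : l.rename id = l := by
  induction l <;> simp_all [rename]

theorem rename_eq_subst (ρ : ℕ → ℕ) (l : Level) : l.rename ρ = l.subst (fun n => idx (ρ n)) := by
  induction l <;> simp_all [rename, subst]

theorem IdxFree.subst_eq {l : Level} (h : l.IdxFree) (τ : ℕ → Level) : l.subst τ = l := by
  induction l <;> simp_all [subst, IdxFree]

theorem lsubst_subst (θ : LevelSubst) (τ : ℕ → Level) (l : Level) :
    (l.subst τ).lsubst θ = (l.lsubst θ).subst (fun n => (τ n).lsubst θ) := by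
  induction l <;> simp_all [subst, lsubst, (θ.idxFree _).subst_eq]

end Level

theorem upRen_comp (ρ ρ' : ℕ → ℕ) :
    (fun n => upRen ρ' (upRen ρ n)) = upRen (fun n => ρ' (ρ n)) := by
  funext n; cases n <;> rfl

theorem upSub_upRen (ρ : ℕ → ℕ) (σ : ℕ → Term) :
    (fun n => upSub σ (upRen ρ n)) = upSub (fun n => σ (ρ n)) := by
  funext n; cases n <;> rfl

theorem upSubC_upRen (ξ : ℕ → ℕ) (τ : ℕ → Level) :
    (fun n => upSubC τ (upRen ξ n)) = upSubC (fun n => τ (ξ n)) := by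
  funext n; cases n <;> rfl

theorem upSub_var : upSub .var = .var := by
  funext n; cases n <;> rfl

theorem upSubC_idx : upSubC .idx = .idx := by
  funext n; cases n <;> rfl

theorem upSub_var_ren (ρ : ℕ → ℕ) :
    (fun n => Term.var (upRen ρ n)) = upSub (fun n => .var (ρ n)) := by
  funext n; cases n <;> rfl

theorem upSubC_idx_ren (ξ : ℕ → ℕ) :
    (fun n => Level.idx (upRen ξ n)) = upSubC (fun n => .idx (ξ n)) := by
  funext n; cases n <;> rfl

theorem upSubC_rename (τ : ℕ → Level) (ξ : ℕ → ℕ) :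
    (fun n => (upSubC τ n).rename (upRen ξ)) = upSubC (fun n => (τ n).rename ξ) := by
  funext n
  cases n
  · rfl
  · simp only [upSubC, Level.rename_rename]; rfl

theorem upSubC_subst (τ τ' : ℕ → Level) :
    (fun n => (upSubC τ n).subst (upSubC τ')) = upSubC (fun n => (τ n).subst τ') := by
  funext n
  cases n
  · rfl
  · simp only [upSubC, Level.subst_rename, Level.rename_subst]

namespace Term

theorem rename_rename (t : Term) (ρ ξ ρ' ξ' : ℕ → ℕ) :
    (t.rename ρ ξ).rename ρ' ξ' = t.rename (fun n => ρ' (ρ n)) (fun n => ξ' (ξ n)) := by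
  induction t generalizing ρ ξ ρ' ξ' <;>
    simp_all [rename, upRen_comp, Level.rename_rename]

theorem subst_rename (t : Term) (ρ ξ : ℕ → ℕ) (σ : ℕ → Term) (τ : ℕ → Level) :
    (t.rename ρ ξ).subst σ τ = t.subst (fun n => σ (ρ n)) (fun n => τ (ξ n)) := by
  induction t generalizing ρ ξ σ τ <;>
    simp_all [rename, subst, upSub_upRen, upSubC_upRen, Level.subst_rename]

theorem rename_shift (t : Term) (ρ ξ : ℕ → ℕ) :
    t.shift.rename (upRen ρ) ξ = (t.rename ρ ξ).shift := by
  simp only [shift, rename_rename]; rfl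

theorem rename_shiftC (t : Term) (ρ ξ : ℕ → ℕ) :
    t.shiftC.rename ρ (upRen ξ) = (t.rename ρ ξ).shiftC := by
  simp only [shiftC, rename_rename]; rfl

theorem upSub_rename (σ : ℕ → Term) (ρ ξ : ℕ → ℕ) :
    (fun n => (upSub σ n).rename (upRen ρ) ξ) = upSub (fun n => (σ n).rename ρ ξ) := by
  funext n
  cases n
  · rfl
  · exact rename_shift _ _ _

theorem rename_subst (t : Term) (σ : ℕ → Term) (τ : ℕ → Level) (ρ ξ : ℕ → ℕ) :
    (t.subst σ τ).rename ρ ξ =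
      t.subst (fun n => (σ n).rename ρ ξ) (fun n => (τ n).rename ξ) := by
  induction t generalizing ρ ξ σ τ <;>
    simp_all [rename, subst, upSub_rename, upSubC_rename, Level.rename_subst, rename_shiftC]

theorem subst_shift (t : Term) (σ : ℕ → Term) (τ : ℕ → Level) :
    t.shift.subst (upSub σ) τ = (t.subst σ τ).shift := by
  simp only [shift, rename_subst, subst_rename, Level.rename_eq_subst]
  simp only [upSub, shift, id, Level.subst_idx]

theorem subst_shiftC (t : Term) (σ : ℕ → Term) (τ : ℕ → Level) :
    t.shiftC.subst (fun n => (σ n).shiftC) (upSubC τ) = (t.subst σ τ).shiftC := by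
  simp only [shiftC, rename_subst, subst_rename, upSubC, id]

theorem upSub_subst (σ σ' : ℕ → Term) (τ' : ℕ → Level) :
    (fun n => (upSub σ n).subst (upSub σ') τ') = upSub (fun n => (σ n).subst σ' τ') := by
  funext n
  cases n
  · rfl
  · exact subst_shift _ _ _

theorem subst_subst (t : Term) (σ : ℕ → Term) (τ : ℕ → Level) (σ' : ℕ → Term) (τ' : ℕ → Level) :
    (t.subst σ τ).subst σ' τ' =
      t.subst (fun n => (σ n).subst σ' τ') (fun n => (τ n).subst τ') := by
  induction t generalizing σ τ σ' τ' <;>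
    simp_all [subst, upSub_subst, upSubC_subst, Level.subst_subst, subst_shiftC]

theorem subst_var (t : Term) : t.subst .var .idx = t := by
  induction t <;> simp_all [subst, upSub_var, upSubC_idx, Level.subst_idx, shiftC, rename]

theorem rename_eq_subst (t : Term) (ρ ξ : ℕ → ℕ) :
    t.rename ρ ξ = t.subst (fun n => .var (ρ n)) (fun n => .idx (ξ n)) := by
  rw [← subst_var (t.rename ρ ξ), subst_rename]

theorem subst_inst (B u : Term) (σ : ℕ → Term) (τ : ℕ → Level) :
    (B.inst u).subst σ τ = (B.subst (upSub σ) τ).inst (u.subst σ τ) := by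
  simp only [inst, subst_subst]
  congr 1
  · funext n
    cases n
    · rfl
    · simp only [upSub, shift, subst_rename, subst]
      exact (subst_var _).symm
  · funext n; simp [Level.subst_idx, Level.subst]

theorem subst_instC (B : Term) (l : Level) (σ : ℕ → Term) (τ : ℕ → Level) :
    (B.instC l).subst σ τ =
      (B.subst (fun n => (σ n).shiftC) (upSubC τ)).instC (l.subst τ) := by
  simp only [instC, subst_subst]
  congr 1
  · funext n
    simp only [shiftC, subst_rename, subst]
    exact (subst_var _).symm
  · funext n
    cases n
    · rfl
    · simp only [upSubC, Level.subst_rename, Level.subst]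
      exact (Level.subst_idx _).symm

theorem rename_inst (B u : Term) (ρ ξ : ℕ → ℕ) :
    (B.inst u).rename ρ ξ = (B.rename (upRen ρ) ξ).inst (u.rename ρ ξ) := by
  simp only [rename_eq_subst, subst_inst, upSub_var_ren]

theorem rename_instC (B : Term) (l : Level) (ρ ξ : ℕ → ℕ) :
    (B.instC l).rename ρ ξ = (B.rename ρ (upRen ξ)).instC (l.rename ξ) := by
  simp only [rename_eq_subst, subst_instC, upSubC_idx_ren, Level.rename_eq_subst]
  rfl

theorem lsubst_rename (θ : LevelSubst) (t : Term) (ρ ξ : ℕ → ℕ) :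
    (t.rename ρ ξ).lsubst θ = (t.lsubst θ).rename ρ ξ := by
  induction t generalizing ρ ξ <;>
    simp_all [rename, lsubst, Level.rename_eq_subst, Level.lsubst_subst, Level.lsubst]

theorem upSub_lsubst (θ : LevelSubst) (σ : ℕ → Term) :
    (fun n => (upSub σ n).lsubst θ) = upSub (fun n => (σ n).lsubst θ) := by
  funext n
  cases n
  · rfl
  · exact lsubst_rename _ _ _ _

theorem upSubC_lsubst (θ : LevelSubst) (τ : ℕ → Level) :
    (fun n => (upSubC τ n).lsubst θ) = upSubC (fun n => (τ n).lsubst θ) := by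
  funext n
  cases n
  · rfl
  · simp [upSubC, Level.rename_eq_subst, Level.lsubst_subst, Level.lsubst]

theorem lsubst_subst (θ : LevelSubst) (t : Term) (σ : ℕ → Term) (τ : ℕ → Level) :
    (t.subst σ τ).lsubst θ =
      (t.lsubst θ).subst (fun n => (σ n).lsubst θ) (fun n => (τ n).lsubst θ) := by
  induction t generalizing σ τ <;>
    simp_all [subst, lsubst, upSub_lsubst, upSubC_lsubst, Level.lsubst_subst, shiftC, lsubst_rename]

theorem lsubst_inst (θ : LevelSubst) (B u : Term) :
    (B.inst u).lsubst θ = (B.lsubst θ).inst (u.lsubst θ) := by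
  simp only [inst, lsubst_subst]
  congr 1
  funext n; cases n <;> rfl

theorem lsubst_instC (θ : LevelSubst) (B : Term) (l : Level) :
    (B.instC l).lsubst θ = (B.lsubst θ).instC (l.lsubst θ) := by
  simp only [instC, lsubst_subst]
  congr 1
  funext n; cases n <;> rfl

end Term

namespace LevelEq

theorem subst_level {l l' : Level} (h : LevelEq l l') (τ : ℕ → Level) :
    LevelEq (l.subst τ) (l'.subst τ) := by
  induction h with
  | refl l => exact .refl _
  | symm _ ih => exact ih.symm
  | trans _ _ ih ih' => exact ih.trans ih'
  | succ_congr _ ih => exact ih.succ_congr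
  | sup_congr _ _ ih ih' => exact ih.sup_congr ih'
  | assoc l₁ l₂ l₃ => exact .assoc _ _ _
  | comm l₁ l₂ => exact .comm _ _
  | succ_sup l₁ l₂ => exact .succ_sup _ _
  | sup_succ l => exact .sup_succ _
  | sup_zero l => exact .sup_zero _
  | sup_idem l => exact .sup_idem _

theorem subst_sub (l : Level) {τ τ' : ℕ → Level} (hτ : ∀ n, LevelEq (τ n) (τ' n)) :
    LevelEq (l.subst τ) (l.subst τ') := by
  induction l with
  | name i => exact .refl _
  | idx n => exact hτ n
  | zero => exact .refl _
  | succ l ih => exact .succ_congr ih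
  | sup l l' ih ih' => exact .sup_congr ih ih'

theorem subst {l l' : Level} (h : LevelEq l l') {τ τ' : ℕ → Level}
    (hτ : ∀ n, LevelEq (τ n) (τ' n)) : LevelEq (l.subst τ) (l'.subst τ') :=
  (h.subst_level τ).trans (subst_sub l' hτ)

theorem rename {l l' : Level} (h : LevelEq l l') (ξ : ℕ → ℕ) :
    LevelEq (l.rename ξ) (l'.rename ξ) := by
  simp only [Level.rename_eq_subst]
  exact h.subst fun _ => .refl _

theorem upSubC {τ τ' : ℕ → Level} (hτ : ∀ n, LevelEq (τ n) (τ' n)) (n : ℕ) :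
    LevelEq (upSubC τ n) (upSubC τ' n) := by
  cases n
  · exact .refl _
  · exact (hτ _).rename _

end LevelEq

/-- A term without free variables of any kind, i.e. one that no substitution changes. -/
structure Term.Closed (t : Term) : Prop where
  subst : ∀ σ τ, t.subst σ τ = t
  lsubst : ∀ θ, t.lsubst θ = t

theorem Term.Closed.rename {t : Term} (h : t.Closed) (ρ ξ : ℕ → ℕ) : t.rename ρ ξ = t := by
  rw [Term.rename_eq_subst, h.subst]

theorem Glob.type_closed (g : Glob) : g.type.Closed := by
  cases g <;> exact ⟨fun _ _ => rfl, fun _ => rfl⟩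

/-- A local signature that declares pairwise distinct constants, with closed types and bodies. -/
structure LocalSig.Regular (Φ : LocalSig) : Prop where
  type_closed : ∀ e ∈ Φ, e.type.Closed
  body_closed : ∀ e ∈ Φ, ∀ t, e.body = some t → t.Closed
  unique : ∀ e ∈ Φ, ∀ e' ∈ Φ, e.name = e'.name → e = e'

theorem Declares.closed {Φ : LocalSig} (hΦ : Φ.Regular) {c : Const} {A : Term}
    (h : Declares Φ c A) : A.Closed := by
  cases h with
  | glob g => exact g.type_closed
  | loc he => exact hΦ.type_closed _ he

theorem Declares.unique {Φ : LocalSig} (hΦ : Φ.Regular) {c : Const} {A A' : Term}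
    (h : Declares Φ c A) (h' : Declares Φ c A') : A = A' := by
  cases h with
  | glob g => cases h'; rfl
  | @loc e he =>
    generalize hc : Const.loc e.name = c at h'
    cases h' with
    | glob g => cases hc
    | loc he' => rw [hΦ.unique _ he _ he' (Const.loc.inj hc)]

/-! ### Confluence modulo the equational theory of levels -/

/-- Parallel reduction, which contracts any set of redexes at once.  Levels may be replaced by equal
ones, and the arguments that a rule of `UPP` discards are left alone. -/
inductive Par (Φ : LocalSig) : Term → Term → Prop
  | var (n) : Par Φ (.var n) (.var n)
  | const (c) : Par Φ (.const c) (.const c)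
  | sort (s) : Par Φ (.sort s) (.sort s)
  | pi {A A' B B'} : Par Φ A A' → Par Φ B B' → Par Φ (.pi A B) (.pi A' B')
  | lam {t t'} : Par Φ t t' → Par Φ (.lam t) (.lam t')
  | app {t t' u u'} : Par Φ t t' → Par Φ u u' → Par Φ (.app t u) (.app t' u')
  | piC {A A' B B'} : Par Φ A A' → Par Φ B B' → Par Φ (.piC A B) (.piC A' B')
  | lamC {t t'} : Par Φ t t' → Par Φ (.lamC t) (.lamC t')
  | appC {t t' l l'} : Par Φ t t' → LevelEq l l' → Par Φ (.appC t l) (.appC t' l')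
  | beta {t t' u u'} : Par Φ t t' → Par Φ u u' → Par Φ (.app (.lam t) u) (t'.inst u')
  | betaC {t t' l l'} : Par Φ t t' → LevelEq l l' → Par Φ (.appC (.lamC t) l) (t'.instC l')
  | delta {e : SigEntry} {c : ℕ} {t : Term} : e ∈ Φ → e.name = c → e.body = some t →
      Par Φ (.const (.loc c)) t
  | tmU (l₁) {l l'} : LevelEq l l' →
      Par Φ (tTm l₁ (tU l)) (tTy l')
  | appLam (l₁ l₂ l₃ l₄ A B A' B') {t t' u u'} : Par Φ t t' → Par Φ u u' →
      Par Φ (tApp l₁ l₂ A B (tLam l₃ l₄ A' B' t) u) (.app t' u')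

variable {Φ : LocalSig}

theorem Par.refl (t : Term) : Par Φ t t := by
  induction t with
  | var n => exact .var n
  | const c => exact .const c
  | sort s => exact .sort s
  | pi A B ihA ihB => exact .pi ihA ihB
  | lam t ih => exact .lam ih
  | app t u iht ihu => exact .app iht ihu
  | piC A B ihA ihB => exact .piC ihA ihB
  | lamC t ih => exact .lamC ih
  | appC t l ih => exact .appC ih (.refl l)

theorem Par.rename (hΦ : Φ.Regular) {t t' : Term} (h : Par Φ t t') (ρ ξ : ℕ → ℕ) :
    Par Φ (t.rename ρ ξ) (t'.rename ρ ξ) := by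
  induction h generalizing ρ ξ with
  | var n => exact .var _
  | const c => exact .const c
  | sort s => exact .sort s
  | pi _ _ ihA ihB => exact .pi (ihA _ _) (ihB _ _)
  | lam _ ih => exact .lam (ih _ _)
  | app _ _ iht ihu => exact .app (iht _ _) (ihu _ _)
  | piC _ _ ihA ihB => exact .piC (ihA _ _) (ihB _ _)
  | lamC _ ih => exact .lamC (ih _ _)
  | appC _ hl ih => exact .appC (ih _ _) (hl.rename _)
  | beta _ _ iht ihu => rw [Term.rename_inst]; exact .beta (iht _ _) (ihu _ _)
  | betaC _ hl ih => rw [Term.rename_instC]; exact .betaC (ih _ _) (hl.rename _)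
  | delta he hc ht => rw [(hΦ.body_closed _ he _ ht).rename]; exact .delta he hc ht
  | tmU l₁ hl => exact .tmU _ (hl.rename _)
  | appLam l₁ l₂ l₃ l₄ A B A' B' _ _ iht ihu =>
    exact .appLam _ _ _ _ _ _ _ _ (iht _ _) (ihu _ _)

theorem Par.upSub (hΦ : Φ.Regular) {σ σ' : ℕ → Term} (hσ : ∀ n, Par Φ (σ n) (σ' n)) (n : ℕ) :
    Par Φ (upSub σ n) (upSub σ' n) := by
  cases n
  · exact .var 0
  · exact (hσ _).rename hΦ _ _

theorem Par.subst (hΦ : Φ.Regular) {t t' : Term} (h : Par Φ t t') {σ σ' : ℕ → Term}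
    {τ τ' : ℕ → Level} (hσ : ∀ n, Par Φ (σ n) (σ' n)) (hτ : ∀ n, LevelEq (τ n) (τ' n)) :
    Par Φ (t.subst σ τ) (t'.subst σ' τ') := by
  induction h generalizing σ σ' τ τ' with
  | var n => exact hσ n
  | const c => exact .const c
  | sort s => exact .sort s
  | pi _ _ ihA ihB => exact .pi (ihA hσ hτ) (ihB (Par.upSub hΦ hσ) hτ)
  | lam _ ih => exact .lam (ih (Par.upSub hΦ hσ) hτ)
  | app _ _ iht ihu => exact .app (iht hσ hτ) (ihu hσ hτ)
  | piC _ _ ihA ihB =>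
    exact .piC (ihA hσ hτ) (ihB (fun n => (hσ n).rename hΦ _ _) (LevelEq.upSubC hτ))
  | lamC _ ih => exact .lamC (ih (fun n => (hσ n).rename hΦ _ _) (LevelEq.upSubC hτ))
  | appC _ hl ih => exact .appC (ih hσ hτ) (hl.subst hτ)
  | beta _ _ iht ihu =>
    rw [Term.subst_inst]
    exact .beta (iht (Par.upSub hΦ hσ) hτ) (ihu hσ hτ)
  | betaC _ hl ih =>
    rw [Term.subst_instC]
    exact .betaC (ih (fun n => (hσ n).rename hΦ _ _) (LevelEq.upSubC hτ)) (hl.subst hτ)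
  | delta he hc ht => rw [(hΦ.body_closed _ he _ ht).subst]; exact .delta he hc ht
  | tmU l₁ hl => exact .tmU _ (hl.subst hτ)
  | appLam l₁ l₂ l₃ l₄ A B A' B' _ _ iht ihu =>
    exact .appLam _ _ _ _ _ _ _ _ (iht hσ hτ) (ihu hσ hτ)

theorem Par.inst (hΦ : Φ.Regular) {B B' u u' : Term} (hB : Par Φ B B') (hu : Par Φ u u') :
    Par Φ (B.inst u) (B'.inst u') := by
  refine hB.subst hΦ (fun n => ?_) fun _ => .refl _
  cases n
  · exact hu
  · exact .var _

theorem Par.instC (hΦ : Φ.Regular) {B B' : Term} {l l' : Level} (hB : Par Φ B B')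
    (hl : LevelEq l l') : Par Φ (B.instC l) (B'.instC l') := by
  refine hB.subst hΦ (fun n => .var n) fun n => ?_
  cases n
  · exact hl
  · exact .refl _

/-- `t'` is a complete development of `t`: all the parallel reducts of `t` reduce to it. -/
def IsDevelopment (Φ : LocalSig) (t t' : Term) : Prop := ∀ u, Par Φ t u → Par Φ u t'

namespace IsDevelopment

theorem var (n : ℕ) : IsDevelopment Φ (.var n) (.var n) := by
  rintro _ ⟨⟩
  exact .var n

theorem sort (s : Srt) : IsDevelopment Φ (.sort s) (.sort s) := by
  rintro _ ⟨⟩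
  exact .sort s

theorem delta (hΦ : Φ.Regular) {e : SigEntry} {t : Term} (he : e ∈ Φ) (ht : e.body = some t) :
    IsDevelopment Φ (.const (.loc e.name)) t := by
  intro u hu
  cases hu with
  | const => exact .delta he rfl ht
  | delta he' hname ht' =>
    cases hΦ.unique _ he' _ he hname
    cases ht.symm.trans ht'
    exact .refl t

theorem const {c : Const} (hc : ∀ e ∈ Φ, ∀ t, e.body = some t → c ≠ .loc e.name) :
    IsDevelopment Φ (.const c) (.const c) := by
  intro u hu
  cases hu with
  | const => exact .const c
  | delta he hname ht => exact absurd (congrArg Const.loc hname.symm) (hc _ he _ ht)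

theorem pi {A A' B B' : Term} (hA : IsDevelopment Φ A A') (hB : IsDevelopment Φ B B') :
    IsDevelopment Φ (.pi A B) (.pi A' B') := by
  rintro _ ⟨⟩
  exact .pi (hA _ ‹_›) (hB _ ‹_›)

theorem lam {t t' : Term} (ht : IsDevelopment Φ t t') : IsDevelopment Φ (.lam t) (.lam t') := by
  rintro _ ⟨⟩
  exact .lam (ht _ ‹_›)

theorem piC {A A' B B' : Term} (hA : IsDevelopment Φ A A') (hB : IsDevelopment Φ B B') :
    IsDevelopment Φ (.piC A B) (.piC A' B') := by
  rintro _ ⟨⟩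
  exact .piC (hA _ ‹_›) (hB _ ‹_›)

theorem lamC {t t' : Term} (ht : IsDevelopment Φ t t') : IsDevelopment Φ (.lamC t) (.lamC t') := by
  rintro _ ⟨⟩
  exact .lamC (ht _ ‹_›)

theorem betaC (hΦ : Φ.Regular) {t t' : Term} (ht : IsDevelopment Φ t t') (l : Level) :
    IsDevelopment Φ (.appC (.lamC t) l) (t'.instC l) := by
  intro u hu
  cases hu with
  | appC hf hl => cases hf with | lamC h => exact .betaC (ht _ h) hl.symm
  | betaC h hl => exact (ht _ h).instC hΦ hl.symm

theorem appC {f f' : Term} (hf : IsDevelopment Φ f f') (hbeta : ∀ t, f ≠ .lamC t) (l : Level) :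
    IsDevelopment Φ (.appC f l) (.appC f' l) := by
  intro u hu
  cases hu with
  | appC h hl => exact .appC (hf _ h) hl.symm
  | betaC => exact absurd rfl (hbeta _)

theorem beta (hΦ : Φ.Regular) {t t' a a' : Term} (ht : IsDevelopment Φ t t')
    (ha : IsDevelopment Φ a a') : IsDevelopment Φ (.app (.lam t) a) (t'.inst a') := by
  intro u hu
  cases hu with
  | app hf h => cases hf with | lam h' => exact .beta (ht _ h') (ha _ h)
  | beta h' h => exact (ht _ h').inst hΦ (ha _ h)

theorem tmU (l₁ l : Level) : IsDevelopment Φ (tTm l₁ (tU l)) (tTy l) := by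
  intro u hu
  cases hu with
  | app hTm hU =>
    cases hTm with | appC hTm _ => cases hTm with | const =>
    cases hU with | appC hU hl => cases hU with | const =>
    exact .tmU _ hl.symm
  | tmU _ hl => exact .appC (.const _) hl.symm

theorem appLam {t t' a a' : Term} (ht : IsDevelopment Φ t t') (ha : IsDevelopment Φ a a')
    (l₁ l₂ l₃ l₄ : Level) (A B A' B' : Term) :
    IsDevelopment Φ (tApp l₁ l₂ A B (tLam l₃ l₄ A' B' t) a) (.app t' a') := by
  intro u hu
  cases hu with
  | app h ha' =>
    cases h with | app h hLam =>
    cases h with | app h _ => cases h with | app h _ => cases h with | appC h _ =>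
    cases h with | appC h _ => cases h with | const =>
    cases hLam with | app h ht' =>
    cases h with | app h _ => cases h with | app h _ => cases h with | appC h _ =>
    cases h with | appC h _ => cases h with | const =>
    exact .appLam _ _ _ _ _ _ _ _ (ht _ ht') (ha _ ha')
  | appLam _ _ _ _ _ _ _ _ ht' ha' => exact .app (ht _ ht') (ha _ ha')

theorem app {f f' a a' : Term} (hf : IsDevelopment Φ f f') (ha : IsDevelopment Φ a a')
    (hbeta : ∀ t, f ≠ .lam t)
    (htmU : ∀ l₁ l, f = .appC (.const (.glob .Tm)) l₁ → a ≠ tU l)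
    (happLam : ∀ l₁ l₂ l₃ l₄ A B A' B' t, .app f a ≠ tApp l₁ l₂ A B (tLam l₃ l₄ A' B' t) a) :
    IsDevelopment Φ (.app f a) (.app f' a') := by
  intro u hu
  cases hu with
  | app h h' => exact .app (hf _ h) (ha _ h')
  | beta => exact absurd rfl (hbeta _)
  | tmU => exact absurd rfl (htmU _ _ rfl)
  | appLam => exact absurd rfl (happLam _ _ _ _ _ _ _ _ _)

theorem exists_const (hΦ : Φ.Regular) (c : Const) : ∃ t', IsDevelopment Φ (.const c) t' := by
  by_cases hc : ∃ e ∈ Φ, ∃ t, e.body = some t ∧ c = .loc e.name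
  · obtain ⟨e, he, t, ht, rfl⟩ := hc
    exact ⟨t, .delta hΦ he ht⟩
  · exact ⟨.const c, .const fun e he t ht h => hc ⟨e, he, t, ht, h⟩⟩

theorem exists_appC (hΦ : Φ.Regular) {f : Term} {l : Level}
    (ih : ∀ s, sizeOf s < sizeOf (Term.appC f l) → ∃ s', IsDevelopment Φ s s') :
    ∃ t', IsDevelopment Φ (.appC f l) t' := by
  by_cases hbeta : ∃ t, f = .lamC t
  · obtain ⟨t, rfl⟩ := hbeta
    obtain ⟨t', ht⟩ := ih t (by simp +arith)
    exact ⟨_, ht.betaC hΦ l⟩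
  · obtain ⟨f', hf⟩ := ih f (by simp +arith)
    exact ⟨_, hf.appC (not_exists.mp hbeta) l⟩

theorem exists_app (hΦ : Φ.Regular) {f a : Term}
    (ih : ∀ s, sizeOf s < sizeOf (Term.app f a) → ∃ s', IsDevelopment Φ s s') :
    ∃ t', IsDevelopment Φ (.app f a) t' := by
  obtain ⟨a', ha⟩ := ih a (by simp)
  by_cases hbeta : ∃ t, f = .lam t
  · obtain ⟨t, rfl⟩ := hbeta
    obtain ⟨t', ht⟩ := ih t (by simp +arith)
    exact ⟨_, ht.beta hΦ ha⟩
  by_cases htmU : ∃ l₁ l, f = .appC (.const (.glob .Tm)) l₁ ∧ a = tU l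
  · obtain ⟨l₁, l, rfl, rfl⟩ := htmU
    exact ⟨_, tmU l₁ l⟩
  by_cases happLam : ∃ l₁ l₂ l₃ l₄ A B A' B' t,
      Term.app f a = tApp l₁ l₂ A B (tLam l₃ l₄ A' B' t) a
  · obtain ⟨l₁, l₂, l₃, l₄, A, B, A', B', t, h⟩ := happLam
    obtain ⟨t', ht⟩ := ih t (by rw [h]; simp +arith [tApp, tLam])
    exact h ▸ ⟨_, ht.appLam ha l₁ l₂ l₃ l₄ A B A' B'⟩
  · obtain ⟨f', hf⟩ := ih f (by simp +arith)
    exact ⟨_, hf.app ha (not_exists.mp hbeta) (fun l₁ l h h' => htmU ⟨l₁, l, h, h'⟩)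
      fun l₁ l₂ l₃ l₄ A B A' B' t h => happLam ⟨l₁, l₂, l₃, l₄, A, B, A', B', t, h⟩⟩

end IsDevelopment

theorem exists_isDevelopment (hΦ : Φ.Regular) (t : Term) : ∃ t', IsDevelopment Φ t t' := by
  induction t using (measure (sizeOf : Term → ℕ)).wf.induction with | _ t ih
  change ∀ s, sizeOf s < sizeOf t → _ at ih
  cases t with
  | var n => exact ⟨_, .var n⟩
  | sort s => exact ⟨_, .sort s⟩
  | const c => exact IsDevelopment.exists_const hΦ c
  | pi A B =>
    obtain ⟨A', hA⟩ := ih A (by simp +arith)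
    obtain ⟨B', hB⟩ := ih B (by simp)
    exact ⟨_, hA.pi hB⟩
  | lam t =>
    obtain ⟨t', ht⟩ := ih t (by simp)
    exact ⟨_, ht.lam⟩
  | piC A B =>
    obtain ⟨A', hA⟩ := ih A (by simp +arith)
    obtain ⟨B', hB⟩ := ih B (by simp)
    exact ⟨_, hA.piC hB⟩
  | lamC t =>
    obtain ⟨t', ht⟩ := ih t (by simp)
    exact ⟨_, ht.lamC⟩
  | app f a => exact IsDevelopment.exists_app hΦ ih
  | appC f l => exact IsDevelopment.exists_appC hΦ ih

theorem Par.diamond (hΦ : Φ.Regular) {t u v : Term} (hu : Par Φ t u) (hv : Par Φ t v) :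
    ∃ w, Par Φ u w ∧ Par Φ v w := by
  obtain ⟨w, hw⟩ := exists_isDevelopment hΦ t
  exact ⟨w, hw u hu, hw v hv⟩

/-! ### Conversion -/

theorem TermEq.par {t u : Term} (h : TermEq t u) : Par Φ t u := by
  induction h with
  | var n => exact .var n
  | const c => exact .const c
  | sort s => exact .sort s
  | pi _ _ ihA ihB => exact .pi ihA ihB
  | lam _ ih => exact .lam ih
  | app _ _ iht ihu => exact .app iht ihu
  | piC _ _ ihA ihB => exact .piC ihA ihB
  | lamC _ ih => exact .lamC ih
  | appC _ hl ih => exact .appC ih hl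

theorem TermEq.refl (t : Term) : TermEq t t := by
  induction t with
  | var n => exact .var n
  | const c => exact .const c
  | sort s => exact .sort s
  | pi A B ihA ihB => exact .pi ihA ihB
  | lam t ih => exact .lam ih
  | app t u iht ihu => exact .app iht ihu
  | piC A B ihA ihB => exact .piC ihA ihB
  | lamC t ih => exact .lamC ih
  | appC t l ih => exact .appC ih (.refl l)

theorem Contracts.par {t u : Term} (h : Contracts Φ t u) : Par Φ t u := by
  cases h with
  | beta t u => exact .beta (.refl _) (.refl _)
  | betaC t l => exact .betaC (.refl _) (.refl _)
  | delta he ht => exact .delta he rfl ht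
  | tmU l' l => exact .tmU _ (.refl _)
  | appLam => exact .appLam _ _ _ _ _ _ _ _ (.refl _) (.refl _)

theorem Step.par {t u : Term} (h : Step Φ t u) : Par Φ t u := by
  induction h with
  | root h => exact h.par
  | pi_dom B _ ih => exact .pi ih (.refl _)
  | pi_cod A _ ih => exact .pi (.refl _) ih
  | lam _ ih => exact .lam ih
  | app_fun u _ ih => exact .app ih (.refl _)
  | app_arg t _ ih => exact .app (.refl _) ih
  | piC_dom B _ ih => exact .piC ih (.refl _)
  | piC_cod A _ ih => exact .piC (.refl _) ih
  | lamC _ ih => exact .lamC ih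
  | appC l _ ih => exact .appC ih (.refl _)

/-- Parallel reduction in any number of steps. -/
def ParStar (Φ : LocalSig) : Term → Term → Prop := Relation.ReflTransGen (Par Φ)

namespace Conv

theorem refl (t : Term) : Conv Φ t t := Relation.EqvGen.refl t

theorem symm {t u : Term} (h : Conv Φ t u) : Conv Φ u t := Relation.EqvGen.symm _ _ h

theorem trans {t u v : Term} (h : Conv Φ t u) (h' : Conv Φ u v) : Conv Φ t v :=
  Relation.EqvGen.trans _ _ _ h h'

theorem of_step {t u : Term} (h : Step Φ t u) : Conv Φ t u := Relation.EqvGen.rel _ _ (.inl h)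

theorem of_termEq {t u : Term} (h : TermEq t u) : Conv Φ t u := Relation.EqvGen.rel _ _ (.inr h)

theorem of_red {t u : Term} (h : Red Φ t u) : Conv Φ t u := by
  induction h with
  | refl => exact .refl t
  | tail _ h ih => exact ih.trans (of_step h)

theorem map {f : Term → Term} (hs : ∀ t u, Step Φ t u → Step Φ (f t) (f u))
    (he : ∀ t u, TermEq t u → TermEq (f t) (f u)) {t u : Term} (h : Conv Φ t u) :
    Conv Φ (f t) (f u) := by
  induction h with
  | rel t u h => exact Relation.EqvGen.rel _ _ (h.imp (hs t u) (he t u))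
  | refl t => exact .refl _
  | symm _ _ _ ih => exact ih.symm
  | trans _ _ _ _ _ ih ih' => exact ih.trans ih'

theorem pi {A A' B B' : Term} (hA : Conv Φ A A') (hB : Conv Φ B B') :
    Conv Φ (.pi A B) (.pi A' B') :=
  (hA.map (f := fun A => .pi A B) (fun _ _ h => .pi_dom B h) fun _ _ h => .pi h (.refl B)).trans
    (hB.map (fun _ _ h => .pi_cod A' h) fun _ _ h => .pi (.refl A') h)

theorem piC {A A' B B' : Term} (hA : Conv Φ A A') (hB : Conv Φ B B') :
    Conv Φ (.piC A B) (.piC A' B') :=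
  (hA.map (f := fun A => .piC A B) (fun _ _ h => .piC_dom B h) fun _ _ h => .piC h (.refl B)).trans
    (hB.map (fun _ _ h => .piC_cod A' h) fun _ _ h => .piC (.refl A') h)

theorem app {t t' u u' : Term} (ht : Conv Φ t t') (hu : Conv Φ u u') :
    Conv Φ (.app t u) (.app t' u') :=
  (ht.map (f := fun t => .app t u) (fun _ _ h => .app_fun u h) fun _ _ h => .app h (.refl u)).trans
    (hu.map (fun _ _ h => .app_arg t' h) fun _ _ h => .app (.refl t') h)

theorem lam {t t' : Term} (ht : Conv Φ t t') : Conv Φ (.lam t) (.lam t') :=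
  ht.map (fun _ _ h => .lam h) fun _ _ h => .lam h

theorem lamC {t t' : Term} (ht : Conv Φ t t') : Conv Φ (.lamC t) (.lamC t') :=
  ht.map (fun _ _ h => .lamC h) fun _ _ h => .lamC h

theorem appC {t t' : Term} {l l' : Level} (ht : Conv Φ t t') (hl : LevelEq l l') :
    Conv Φ (.appC t l) (.appC t' l') :=
  (ht.map (f := fun t => .appC t l) (fun _ _ h => .appC l h) fun _ _ h => .appC h (.refl l)).trans
    (of_termEq (.appC (.refl t') hl))

theorem of_par {t u : Term} (h : Par Φ t u) : Conv Φ t u := by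
  induction h with
  | var n => exact .refl _
  | const c => exact .refl _
  | sort s => exact .refl _
  | pi _ _ ihA ihB => exact ihA.pi ihB
  | lam _ ih => exact ih.lam
  | app _ _ iht ihu => exact iht.app ihu
  | piC _ _ ihA ihB => exact ihA.piC ihB
  | lamC _ ih => exact ih.lamC
  | appC _ hl ih => exact ih.appC hl
  | beta _ _ iht ihu => exact (iht.lam.app ihu).trans (of_step (.root (.beta _ _)))
  | betaC _ hl ih => exact (ih.lamC.appC hl).trans (of_step (.root (.betaC _ _)))
  | delta he hc ht => subst hc; exact of_step (.root (.delta he ht))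
  | tmU l₁ hl => exact (of_step (.root (.tmU _ _))).trans ((refl _).appC hl)
  | appLam l₁ l₂ l₃ l₄ A B A' B' _ _ iht ihu =>
    exact (of_step (.root (.appLam _ _ _ _ _ _ _ _ _ _))).trans (iht.app ihu)

theorem subst (hΦ : Φ.Regular) {t u : Term} (h : Conv Φ t u) (σ : ℕ → Term) (τ : ℕ → Level) :
    Conv Φ (t.subst σ τ) (u.subst σ τ) := by
  induction h with
  | rel t u h =>
    exact of_par ((h.elim Step.par TermEq.par).subst hΦ (fun _ => .refl _) fun _ => .refl _)
  | refl t => exact .refl _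
  | symm _ _ _ ih => exact ih.symm
  | trans _ _ _ _ _ ih ih' => exact ih.trans ih'

theorem rename (hΦ : Φ.Regular) {t u : Term} (h : Conv Φ t u) (ρ ξ : ℕ → ℕ) :
    Conv Φ (t.rename ρ ξ) (u.rename ρ ξ) := by
  simp only [Term.rename_eq_subst]
  exact h.subst hΦ _ _

theorem inst (hΦ : Φ.Regular) {t t' : Term} (h : Conv Φ t t') (u : Term) :
    Conv Φ (t.inst u) (t'.inst u) := h.subst hΦ _ _

theorem instC (hΦ : Φ.Regular) {t t' : Term} (h : Conv Φ t t') (l : Level) :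
    Conv Φ (t.instC l) (t'.instC l) := h.subst hΦ _ _

theorem church_rosser (hΦ : Φ.Regular) {t u : Term} (h : Conv Φ t u) :
    ∃ v, ParStar Φ t v ∧ ParStar Φ u v := by
  have hjoin := Relation.equivalence_join_reflTransGen (r := Par Φ) fun _ _ _ hu hv =>
    let ⟨w, huw, hvw⟩ := Par.diamond hΦ hu hv
    ⟨w, .single huw, .single hvw⟩
  induction h with
  | rel t u h => exact ⟨u, .single (h.elim Step.par TermEq.par), .refl⟩
  | refl t => exact hjoin.refl t
  | symm _ _ _ ih => exact hjoin.symm ih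
  | trans _ _ _ _ _ ih ih' => exact hjoin.trans ih ih'

end Conv

namespace ParStar

theorem pi_inv {A B v : Term} (h : ParStar Φ (.pi A B) v) :
    ∃ A' B', v = .pi A' B' ∧ Conv Φ A A' ∧ Conv Φ B B' := by
  induction h with
  | refl => exact ⟨A, B, rfl, .refl A, .refl B⟩
  | tail _ h ih =>
    obtain ⟨A', B', rfl, hA, hB⟩ := ih
    cases h with
    | pi hA' hB' => exact ⟨_, _, rfl, hA.trans (.of_par hA'), hB.trans (.of_par hB')⟩

theorem piC_inv {A B v : Term} (h : ParStar Φ (.piC A B) v) :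
    ∃ A' B', v = .piC A' B' ∧ Conv Φ A A' ∧ Conv Φ B B' := by
  induction h with
  | refl => exact ⟨A, B, rfl, .refl A, .refl B⟩
  | tail _ h ih =>
    obtain ⟨A', B', rfl, hA, hB⟩ := ih
    cases h with
    | piC hA' hB' => exact ⟨_, _, rfl, hA.trans (.of_par hA'), hB.trans (.of_par hB')⟩

theorem tTm_tPi_inv {l₀ l l' : Level} {A B v : Term} (h : ParStar Φ (tTm l₀ (tPi l l' A B)) v) :
    ∃ l₀' m m' A' B', v = tTm l₀' (tPi m m' A' B') ∧ LevelEq l m ∧ LevelEq l' m' ∧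
      Conv Φ A A' ∧ Conv Φ B B' := by
  induction h with
  | refl => exact ⟨_, _, _, _, _, rfl, .refl _, .refl _, .refl _, .refl _⟩
  | tail _ h ih =>
    obtain ⟨l₀', m, m', A', B', rfl, hl, hl', hA, hB⟩ := ih
    unfold tTm tPi at h
    cases h with | app hTm hPi =>
    cases hTm with | appC hTm _ => cases hTm with | const =>
    cases hPi with | app hPi hB' => cases hPi with | app hPi hA' =>
    cases hPi with | appC hPi hm' => cases hPi with | appC hPi hm => cases hPi with | const =>
    exact ⟨_, _, _, _, _, rfl, hl.trans hm, hl'.trans hm', hA.trans (.of_par hA'),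
      hB.trans (.of_par hB')⟩

end ParStar

namespace Conv

theorem pi_inj (hΦ : Φ.Regular) {A B A' B' : Term} (h : Conv Φ (.pi A B) (.pi A' B')) :
    Conv Φ A A' ∧ Conv Φ B B' := by
  obtain ⟨v, h₁, h₂⟩ := h.church_rosser hΦ
  obtain ⟨A₁, B₁, rfl, hA, hB⟩ := h₁.pi_inv
  obtain ⟨A₂, B₂, hv, hA', hB'⟩ := h₂.pi_inv
  cases hv
  exact ⟨hA.trans hA'.symm, hB.trans hB'.symm⟩

theorem piC_inj (hΦ : Φ.Regular) {A B A' B' : Term} (h : Conv Φ (.piC A B) (.piC A' B')) :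
    Conv Φ A A' ∧ Conv Φ B B' := by
  obtain ⟨v, h₁, h₂⟩ := h.church_rosser hΦ
  obtain ⟨A₁, B₁, rfl, hA, hB⟩ := h₁.piC_inv
  obtain ⟨A₂, B₂, hv, hA', hB'⟩ := h₂.piC_inv
  cases hv
  exact ⟨hA.trans hA'.symm, hB.trans hB'.symm⟩

theorem tTm_tPi_inj (hΦ : Φ.Regular) {l₁ l₂ l l' m m' : Level} {A B A' B' : Term}
    (h : Conv Φ (tTm l₁ (tPi l l' A B)) (tTm l₂ (tPi m m' A' B'))) :
    LevelEq l m ∧ LevelEq l' m' ∧ Conv Φ A A' ∧ Conv Φ B B' := by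
  obtain ⟨v, h₁, h₂⟩ := h.church_rosser hΦ
  obtain ⟨_, _, _, _, _, rfl, hl, hl', hA, hB⟩ := h₁.tTm_tPi_inv
  obtain ⟨_, _, _, _, _, hv, hm, hm', hA', hB'⟩ := h₂.tTm_tPi_inv
  cases hv
  exact ⟨hl.trans hm.symm, hl'.trans hm'.symm, hA.trans hA'.symm, hB.trans hB'.symm⟩

end Conv

/-! ### Renaming and substitution in derivations -/

variable {Ξ : Finset ℕ}

theorem Der.wf {Γ : Ctx} {J : Judgment} (h : Der Φ Ξ Γ J) : Der Φ Ξ Γ .wf := by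
  induction h with
  | emptyCtx => exact .emptyCtx
  | extCtx h _ => exact .extCtx h
  | extCtxC h _ => exact .extCtxC h
  | sort h => exact h
  | var _ h => exact h
  | varC _ h => exact h
  | varΞ _ h => exact h
  | cons _ h => exact h
  | zero h => exact h
  | succ _ ih => exact ih
  | sup _ _ ih => exact ih
  | conv _ _ _ ih => exact ih
  | convC _ _ _ ih => exact ih
  | arrow _ _ ih => exact ih
  | arrowC _ _ ih => exact ih
  | abs _ _ _ ih => exact ih
  | absC _ _ _ ih => exact ih
  | app _ _ ih => exact ih
  | appC _ _ ih => exact ih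

theorem Der.lvl {Γ : Ctx} (h : Der Φ Ξ Γ .wf) : Der Φ Ξ Γ (.term tLvl (.sort .type)) :=
  .cons (.glob .Lvl) h

/-- Simultaneous substitution in a judgment. -/
def Judgment.subst (σ : ℕ → Term) (τ : ℕ → Level) : Judgment → Judgment
  | wf => wf
  | term t A => term (t.subst σ τ) (A.subst σ τ)
  | level l A => level (l.subst τ) (A.subst σ τ)

/-- Simultaneous renaming in a judgment. -/
def Judgment.rename (ρ ξ : ℕ → ℕ) : Judgment → Judgment
  | wf => wf
  | term t A => term (t.rename ρ ξ) (A.rename ρ ξ)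
  | level l A => level (l.rename ξ) (A.rename ρ ξ)

/-- `ρ` and `ξ` rename the variables of `Γ` to variables of `Γ'` of the same types. -/
structure Ctx.Ren (Γ Γ' : Ctx) (ρ ξ : ℕ → ℕ) : Prop where
  var : ∀ {n A}, Ctx.HasVar Γ n A → Ctx.HasVar Γ' (ρ n) (A.rename ρ ξ)
  varC : ∀ {n A}, Ctx.HasVarC Γ n A → Ctx.HasVarC Γ' (ξ n) (A.rename ρ ξ)

namespace Ctx.Ren

theorem up {Γ Γ' : Ctx} {ρ ξ : ℕ → ℕ} (h : Ctx.Ren Γ Γ' ρ ξ) (A : Term) :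
    Ctx.Ren (.reg A :: Γ) (.reg (A.rename ρ ξ) :: Γ') (upRen ρ) ξ where
  var hn := by
    cases hn with
    | here => rw [Term.rename_shift]; exact .here _ _
    | reg _ hn => rw [Term.rename_shift]; exact .reg _ (h.var hn)
  varC hn := by
    cases hn with
    | reg _ hn => rw [Term.rename_shift]; exact .reg _ (h.varC hn)

theorem upC {Γ Γ' : Ctx} {ρ ξ : ℕ → ℕ} (h : Ctx.Ren Γ Γ' ρ ξ) (A : Term) :
    Ctx.Ren (.conf A :: Γ) (.conf (A.rename ρ ξ) :: Γ') ρ (upRen ξ) where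
  var hn := by
    cases hn with
    | conf _ hn => rw [Term.rename_shiftC]; exact .conf _ (h.var hn)
  varC hn := by
    cases hn with
    | here => rw [Term.rename_shiftC]; exact .here _ _
    | conf _ hn => rw [Term.rename_shiftC]; exact .conf _ (h.varC hn)

theorem shift (Γ : Ctx) (A : Term) : Ctx.Ren Γ (.reg A :: Γ) Nat.succ id :=
  ⟨fun h => .reg _ h, fun h => .reg _ h⟩

theorem shiftC (Γ : Ctx) (A : Term) : Ctx.Ren Γ (.conf A :: Γ) id Nat.succ :=
  ⟨fun h => .conf _ h, fun h => .conf _ h⟩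

end Ctx.Ren

theorem Der.rename (hΦ : Φ.Regular) {Γ : Ctx} {J : Judgment} (h : Der Φ Ξ Γ J) {Γ' : Ctx}
    {ρ ξ : ℕ → ℕ} (hr : Ctx.Ren Γ Γ' ρ ξ) (hw : Der Φ Ξ Γ' .wf) :
    Der Φ Ξ Γ' (J.rename ρ ξ) := by
  induction h generalizing Γ' ρ ξ with
  | emptyCtx => exact hw
  | extCtx _ _ => exact hw
  | extCtxC _ _ => exact hw
  | sort _ _ => exact .sort hw
  | var hn _ _ => exact .var (hr.var hn) hw
  | varC hn _ _ => exact .varC (hr.varC hn) hw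
  | varΞ hj _ _ => exact .varΞ hj hw
  | cons hc _ _ =>
    simp only [Judgment.rename, Term.rename, (hc.closed hΦ).rename]
    exact .cons hc hw
  | zero _ _ => exact .zero hw
  | succ _ ih => exact .succ (ih hr hw)
  | sup _ _ ih ih' => exact .sup (ih hr hw) (ih' hr hw)
  | conv hAB _ _ ih ih' => exact .conv (hAB.rename hΦ _ _) (ih hr hw) (ih' hr hw)
  | convC hAB _ _ ih ih' => exact .convC (hAB.rename hΦ _ _) (ih hr hw) (ih' hr hw)
  | arrow _ _ ihA ihB =>
    have hA := ihA hr hw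
    exact .arrow hA (ihB (hr.up _) (.extCtx hA))
  | arrowC _ _ ihA ihB =>
    have hA := ihA hr hw
    exact .arrowC hA (ihB (hr.upC _) (.extCtxC hA))
  | abs _ _ _ ihA ihB iht =>
    have hA := ihA hr hw
    exact .abs hA (ihB (hr.up _) (.extCtx hA)) (iht (hr.up _) (.extCtx hA))
  | absC _ _ _ ihA ihB iht =>
    have hA := ihA hr hw
    exact .absC hA (ihB (hr.upC _) (.extCtxC hA)) (iht (hr.upC _) (.extCtxC hA))
  | app _ _ iht ihu =>
    simp only [Judgment.rename, Term.rename_inst]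
    exact .app (iht hr hw) (ihu hr hw)
  | appC _ _ iht ihl =>
    simp only [Judgment.rename, Term.rename_instC]
    exact .appC (iht hr hw) (ihl hr hw)

theorem Der.shift (hΦ : Φ.Regular) {Γ : Ctx} {t A B : Term} (h : Der Φ Ξ Γ (.term t A))
    (hB : Der Φ Ξ Γ (.term B (.sort .type))) :
    Der Φ Ξ (.reg B :: Γ) (.term t.shift A.shift) :=
  h.rename hΦ (Ctx.Ren.shift Γ B) (.extCtx hB)

theorem Der.shiftC (hΦ : Φ.Regular) {Γ : Ctx} {t A B : Term} (h : Der Φ Ξ Γ (.term t A))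
    (hB : Der Φ Ξ Γ (.term B (.sort .type))) :
    Der Φ Ξ (.conf B :: Γ) (.term t.shiftC A.shiftC) :=
  h.rename hΦ (Ctx.Ren.shiftC Γ B) (.extCtxC hB)

theorem Der.level_shift (hΦ : Φ.Regular) {Γ : Ctx} {l : Level} {A B : Term}
    (h : Der Φ Ξ Γ (.level l A)) (hB : Der Φ Ξ Γ (.term B (.sort .type))) :
    Der Φ Ξ (.reg B :: Γ) (.level l A.shift) := by
  have h' := h.rename hΦ (Ctx.Ren.shift Γ B) (.extCtx hB)
  rwa [Judgment.rename, Level.rename_id] at h'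

/-- `σ` and `τ` map the variables of `Γ` to terms and levels over `Γ'` of the same types. -/
structure IsSubst (Φ : LocalSig) (Ξ : Finset ℕ) (Γ Γ' : Ctx) (σ : ℕ → Term) (τ : ℕ → Level) :
    Prop where
  var : ∀ {n A}, Ctx.HasVar Γ n A → Der Φ Ξ Γ' (.term (σ n) (A.subst σ τ))
  varC : ∀ {n A}, Ctx.HasVarC Γ n A → Der Φ Ξ Γ' (.level (τ n) (A.subst σ τ))

namespace IsSubst

theorem up (hΦ : Φ.Regular) {Γ Γ' : Ctx} {σ : ℕ → Term} {τ : ℕ → Level}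
    (h : IsSubst Φ Ξ Γ Γ' σ τ) {A : Term} (hA : Der Φ Ξ Γ' (.term (A.subst σ τ) (.sort .type))) :
    IsSubst Φ Ξ (.reg A :: Γ) (.reg (A.subst σ τ) :: Γ') (upSub σ) τ where
  var hn := by
    cases hn with
    | here => rw [Term.subst_shift]; exact .var (.here _ _) (.extCtx hA)
    | reg _ hn => rw [Term.subst_shift]; exact (h.var hn).shift hΦ hA
  varC hn := by
    cases hn with
    | reg _ hn => rw [Term.subst_shift]; exact (h.varC hn).level_shift hΦ hA

theorem upC (hΦ : Φ.Regular) {Γ Γ' : Ctx} {σ : ℕ → Term} {τ : ℕ → Level}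
    (h : IsSubst Φ Ξ Γ Γ' σ τ) {A : Term} (hA : Der Φ Ξ Γ' (.term (A.subst σ τ) (.sort .type))) :
    IsSubst Φ Ξ (.conf A :: Γ) (.conf (A.subst σ τ) :: Γ') (fun n => (σ n).shiftC)
      (upSubC τ) where
  var hn := by
    cases hn with
    | conf _ hn => rw [Term.subst_shiftC]; exact (h.var hn).shiftC hΦ hA
  varC hn := by
    cases hn with
    | here => rw [Term.subst_shiftC]; exact .varC (.here _ _) (.extCtxC hA)
    | conf _ hn =>
      rw [Term.subst_shiftC]
      exact (h.varC hn).rename hΦ (Ctx.Ren.shiftC Γ' _) (.extCtxC hA)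

end IsSubst

theorem Der.subst (hΦ : Φ.Regular) {Γ : Ctx} {J : Judgment} (h : Der Φ Ξ Γ J) {Γ' : Ctx}
    {σ : ℕ → Term} {τ : ℕ → Level} (hs : IsSubst Φ Ξ Γ Γ' σ τ) (hw : Der Φ Ξ Γ' .wf) :
    Der Φ Ξ Γ' (J.subst σ τ) := by
  induction h generalizing Γ' σ τ with
  | emptyCtx => exact hw
  | extCtx _ _ => exact hw
  | extCtxC _ _ => exact hw
  | sort _ _ => exact .sort hw
  | var hn _ _ => exact hs.var hn
  | varC hn _ _ => exact hs.varC hn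
  | varΞ hj _ _ => exact .varΞ hj hw
  | cons hc _ _ =>
    simp only [Judgment.subst, Term.subst, (hc.closed hΦ).subst]
    exact .cons hc hw
  | zero _ _ => exact .zero hw
  | succ _ ih => exact .succ (ih hs hw)
  | sup _ _ ih ih' => exact .sup (ih hs hw) (ih' hs hw)
  | conv hAB _ _ ih ih' => exact .conv (hAB.subst hΦ _ _) (ih hs hw) (ih' hs hw)
  | convC hAB _ _ ih ih' => exact .convC (hAB.subst hΦ _ _) (ih hs hw) (ih' hs hw)
  | arrow _ _ ihA ihB =>
    have hA := ihA hs hw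
    exact .arrow hA (ihB (hs.up hΦ hA) (.extCtx hA))
  | arrowC _ _ ihA ihB =>
    have hA := ihA hs hw
    exact .arrowC hA (ihB (hs.upC hΦ hA) (.extCtxC hA))
  | abs _ _ _ ihA ihB iht =>
    have hA := ihA hs hw
    exact .abs hA (ihB (hs.up hΦ hA) (.extCtx hA)) (iht (hs.up hΦ hA) (.extCtx hA))
  | absC _ _ _ ihA ihB iht =>
    have hA := ihA hs hw
    exact .absC hA (ihB (hs.upC hΦ hA) (.extCtxC hA)) (iht (hs.upC hΦ hA) (.extCtxC hA))
  | app _ _ iht ihu =>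
    simp only [Judgment.subst, Term.subst_inst]
    exact .app (iht hs hw) (ihu hs hw)
  | appC _ _ iht ihl =>
    simp only [Judgment.subst, Term.subst_instC]
    exact .appC (iht hs hw) (ihl hs hw)

/-- The substitution behind `Term.inst`. -/
def instSub (u : Term) : ℕ → Term
  | 0 => u
  | n + 1 => .var n

/-- The substitution behind `Term.instC`. -/
def instSubC (l : Level) : ℕ → Level
  | 0 => l
  | n + 1 => .idx n

theorem Term.subst_instSub_shift (t u : Term) : t.shift.subst (instSub u) .idx = t := by
  rw [shift, subst_rename]
  exact t.subst_var

theorem Term.subst_instSubC_shiftC (t : Term) (l : Level) :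
    t.shiftC.subst .var (instSubC l) = t := by
  rw [shiftC, subst_rename]
  exact t.subst_var

theorem Judgment.subst_var (J : Judgment) : J.subst .var .idx = J := by
  cases J <;> simp only [subst, Term.subst_var, Level.subst_idx]

namespace IsSubst

theorem inst {Γ : Ctx} {A u : Term} (hu : Der Φ Ξ Γ (.term u A)) :
    IsSubst Φ Ξ (.reg A :: Γ) Γ (instSub u) .idx where
  var hn := by
    cases hn with
    | here => rw [Term.subst_instSub_shift]; exact hu
    | reg _ hn => rw [Term.subst_instSub_shift]; exact .var hn hu.wf
  varC hn := by
    cases hn with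
    | reg _ hn => rw [Term.subst_instSub_shift]; exact .varC hn hu.wf

theorem instC {Γ : Ctx} {A : Term} {l : Level} (hl : Der Φ Ξ Γ (.level l A)) :
    IsSubst Φ Ξ (.conf A :: Γ) Γ .var (instSubC l) where
  var hn := by
    cases hn with
    | conf _ hn => rw [Term.subst_instSubC_shiftC]; exact .var hn hl.wf
  varC hn := by
    cases hn with
    | here => rw [Term.subst_instSubC_shiftC]; exact hl
    | conf _ hn => rw [Term.subst_instSubC_shiftC]; exact .varC hn hl.wf

theorem conv_reg (hΦ : Φ.Regular) {Γ : Ctx} {A A' : Term} (hAA' : Conv Φ A A')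
    (hA : Der Φ Ξ Γ (.term A (.sort .type))) (hA' : Der Φ Ξ Γ (.term A' (.sort .type))) :
    IsSubst Φ Ξ (.reg A :: Γ) (.reg A' :: Γ) .var .idx where
  var hn := by
    rw [Term.subst_var]
    cases hn with
    | here =>
      exact .conv (hAA'.symm.rename hΦ _ _) (.var (.here _ _) (.extCtx hA')) (hA.shift hΦ hA')
    | reg _ hn => exact .var (.reg _ hn) (.extCtx hA')
  varC hn := by
    rw [Term.subst_var]
    cases hn with
    | reg _ hn => exact .varC (.reg _ hn) (.extCtx hA')

theorem conv_conf (hΦ : Φ.Regular) {Γ : Ctx} {A A' : Term} (hAA' : Conv Φ A A')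
    (hA : Der Φ Ξ Γ (.term A (.sort .type))) (hA' : Der Φ Ξ Γ (.term A' (.sort .type))) :
    IsSubst Φ Ξ (.conf A :: Γ) (.conf A' :: Γ) .var .idx where
  var hn := by
    rw [Term.subst_var]
    cases hn with
    | conf _ hn => exact .var (.conf _ hn) (.extCtxC hA')
  varC hn := by
    rw [Term.subst_var]
    cases hn with
    | here =>
      exact .convC (hAA'.symm.rename hΦ _ _) (.varC (.here _ _) (.extCtxC hA')) (hA.shiftC hΦ hA')
    | conf _ hn => exact .varC (.conf _ hn) (.extCtxC hA')

end IsSubst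

namespace Der

theorem inst (hΦ : Φ.Regular) {Γ : Ctx} {A u t B : Term} (h : Der Φ Ξ (.reg A :: Γ) (.term t B))
    (hu : Der Φ Ξ Γ (.term u A)) : Der Φ Ξ Γ (.term (t.inst u) (B.inst u)) :=
  h.subst hΦ (.inst hu) hu.wf

theorem instC (hΦ : Φ.Regular) {Γ : Ctx} {A t B : Term} {l : Level}
    (h : Der Φ Ξ (.conf A :: Γ) (.term t B)) (hl : Der Φ Ξ Γ (.level l A)) :
    Der Φ Ξ Γ (.term (t.instC l) (B.instC l)) :=
  h.subst hΦ (.instC hl) hl.wf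

theorem conv_ctx (hΦ : Φ.Regular) {Γ : Ctx} {A A' : Term} {J : Judgment}
    (h : Der Φ Ξ (.reg A :: Γ) J) (hAA' : Conv Φ A A')
    (hA : Der Φ Ξ Γ (.term A (.sort .type))) (hA' : Der Φ Ξ Γ (.term A' (.sort .type))) :
    Der Φ Ξ (.reg A' :: Γ) J :=
  J.subst_var ▸ h.subst hΦ (.conv_reg hΦ hAA' hA hA') (.extCtx hA')

theorem conv_ctxC (hΦ : Φ.Regular) {Γ : Ctx} {A A' : Term} {J : Judgment}
    (h : Der Φ Ξ (.conf A :: Γ) J) (hAA' : Conv Φ A A')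
    (hA : Der Φ Ξ Γ (.term A (.sort .type))) (hA' : Der Φ Ξ Γ (.term A' (.sort .type))) :
    Der Φ Ξ (.conf A' :: Γ) J :=
  J.subst_var ▸ h.subst hΦ (.conv_conf hΦ hAA' hA hA') (.extCtxC hA')

theorem of_nil (hΦ : Φ.Regular) {Γ : Ctx} {J : Judgment} (h : Der Φ Ξ [] J)
    (hw : Der Φ Ξ Γ .wf) : Der Φ Ξ Γ J :=
  J.subst_var ▸ h.subst hΦ ⟨nofun, nofun⟩ hw

end Der

/-! ### Weakening of the signature and closedness of derivable terms -/

theorem Contracts.mono {Φ' : LocalSig} (hs : Φ ⊆ Φ') {t u : Term} (h : Contracts Φ t u) :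
    Contracts Φ' t u := by
  cases h with
  | beta t u => exact .beta t u
  | betaC t l => exact .betaC t l
  | delta he ht => exact .delta (hs he) ht
  | tmU l' l => exact .tmU l' l
  | appLam => exact .appLam _ _ _ _ _ _ _ _ _ _

theorem Step.mono {Φ' : LocalSig} (hs : Φ ⊆ Φ') {t u : Term} (h : Step Φ t u) : Step Φ' t u := by
  induction h with
  | root h => exact .root (h.mono hs)
  | pi_dom B _ ih => exact .pi_dom B ih
  | pi_cod A _ ih => exact .pi_cod A ih
  | lam _ ih => exact .lam ih
  | app_fun u _ ih => exact .app_fun u ih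
  | app_arg t _ ih => exact .app_arg t ih
  | piC_dom B _ ih => exact .piC_dom B ih
  | piC_cod A _ ih => exact .piC_cod A ih
  | lamC _ ih => exact .lamC ih
  | appC l _ ih => exact .appC l ih

theorem Conv.mono {Φ' : LocalSig} (hs : Φ ⊆ Φ') {t u : Term} (h : Conv Φ t u) : Conv Φ' t u :=
  Relation.EqvGen.mono (fun _ _ => Or.imp_left (Step.mono hs)) _ _ h

theorem Declares.mono {Φ' : LocalSig} (hs : Φ ⊆ Φ') {c : Const} {A : Term}
    (h : Declares Φ c A) : Declares Φ' c A := by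
  cases h with
  | glob g => exact .glob g
  | loc he => exact .loc (hs he)

theorem Der.mono {Φ' : LocalSig} (hs : Φ ⊆ Φ') {Ξ' : Finset ℕ} (hΞ : Ξ ⊆ Ξ') {Γ : Ctx}
    {J : Judgment} (h : Der Φ Ξ Γ J) : Der Φ' Ξ' Γ J := by
  induction h with
  | emptyCtx => exact .emptyCtx
  | extCtx _ ih => exact .extCtx ih
  | extCtxC _ ih => exact .extCtxC ih
  | sort _ ih => exact .sort ih
  | var hn _ ih => exact .var hn ih
  | varC hn _ ih => exact .varC hn ih
  | varΞ hj _ ih => exact .varΞ (hΞ hj) ih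
  | cons hc _ ih => exact .cons (hc.mono hs) ih
  | zero _ ih => exact .zero ih
  | succ _ ih => exact .succ ih
  | sup _ _ ih ih' => exact .sup ih ih'
  | conv hAB _ _ ih ih' => exact .conv (hAB.mono hs) ih ih'
  | convC hAB _ _ ih ih' => exact .convC (hAB.mono hs) ih ih'
  | arrow _ _ ihA ihB => exact .arrow ihA ihB
  | arrowC _ _ ihA ihB => exact .arrowC ihA ihB
  | abs _ _ _ ihA ihB iht => exact .abs ihA ihB iht
  | absC _ _ _ ihA ihB iht => exact .absC ihA ihB iht
  | app _ _ iht ihu => exact .app iht ihu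
  | appC _ _ iht ihl => exact .appC iht ihl

/-- The subject of a judgment is a fixed point of the operation `f` on terms or `g` on levels. -/
def Judgment.SubjectFixedBy (f : Term → Term) (g : Level → Level) : Judgment → Prop
  | wf => True
  | term t _ => f t = t
  | level l _ => g l = l

/-- The substitution `σ`, `τ` leaves the variables of `Γ` unchanged. -/
structure Ctx.FixedBy (Γ : Ctx) (σ : ℕ → Term) (τ : ℕ → Level) : Prop where
  var : ∀ {n A}, Ctx.HasVar Γ n A → σ n = .var n
  varC : ∀ {n A}, Ctx.HasVarC Γ n A → τ n = .idx n

namespace Ctx.FixedBy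

theorem up {Γ : Ctx} {σ : ℕ → Term} {τ : ℕ → Level} (h : Γ.FixedBy σ τ) (A : Term) :
    Ctx.FixedBy (.reg A :: Γ) (upSub σ) τ where
  var hn := by
    cases hn with
    | here => rfl
    | reg _ hn => rw [upSub, h.var hn]; rfl
  varC hn := by
    cases hn with
    | reg _ hn => exact h.varC hn

theorem upC {Γ : Ctx} {σ : ℕ → Term} {τ : ℕ → Level} (h : Γ.FixedBy σ τ) (A : Term) :
    Ctx.FixedBy (.conf A :: Γ) (fun n => (σ n).shiftC) (upSubC τ) where
  var hn := by
    cases hn with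
    | conf _ hn => rw [h.var hn]; rfl
  varC hn := by
    cases hn with
    | here => rfl
    | conf _ hn => rw [upSubC, h.varC hn]; rfl

end Ctx.FixedBy

theorem Der.subst_eq {Γ : Ctx} {J : Judgment} (h : Der Φ Ξ Γ J) {σ : ℕ → Term} {τ : ℕ → Level}
    (hf : Γ.FixedBy σ τ) : J.SubjectFixedBy (Term.subst σ τ) (Level.subst τ) := by
  induction h generalizing σ τ with
  | emptyCtx => trivial
  | extCtx _ _ => trivial
  | extCtxC _ _ => trivial
  | sort _ _ => rfl
  | var hn _ _ => exact hf.var hn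
  | varC hn _ _ => exact hf.varC hn
  | varΞ _ _ _ => rfl
  | cons _ _ _ => rfl
  | zero _ _ => rfl
  | succ _ ih => exact congrArg _ (ih hf)
  | sup _ _ ih ih' => exact congrArg₂ _ (ih hf) (ih' hf)
  | conv _ _ _ ih _ => exact ih hf
  | convC _ _ _ ih _ => exact ih hf
  | arrow _ _ ihA ihB => exact congrArg₂ _ (ihA hf) (ihB (hf.up _))
  | arrowC _ _ ihA ihB => exact congrArg₂ _ (ihA hf) (ihB (hf.upC _))
  | abs _ _ _ _ _ iht => exact congrArg _ (iht (hf.up _))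
  | absC _ _ _ _ _ iht => exact congrArg _ (iht (hf.upC _))
  | app _ _ iht ihu => exact congrArg₂ _ (iht hf) (ihu hf)
  | appC _ _ iht ihl => exact congrArg₂ _ (iht hf) (ihl hf)

theorem Der.lsubst_eq {Γ : Ctx} {J : Judgment} (h : Der Φ Ξ Γ J) {θ : LevelSubst}
    (hθ : ∀ j ∈ Ξ, θ.toFun j = .name j) :
    J.SubjectFixedBy (Term.lsubst θ) (Level.lsubst θ) := by
  induction h with
  | emptyCtx => trivial
  | extCtx _ _ => trivial
  | extCtxC _ _ => trivial
  | sort _ _ => rfl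
  | var _ _ _ => rfl
  | varC _ _ _ => rfl
  | varΞ hj _ _ => exact hθ _ hj
  | cons _ _ _ => rfl
  | zero _ _ => rfl
  | succ _ ih => exact congrArg _ ih
  | sup _ _ ih ih' => exact congrArg₂ _ ih ih'
  | conv _ _ _ ih _ => exact ih
  | convC _ _ _ ih _ => exact ih
  | arrow _ _ ihA ihB => exact congrArg₂ _ ihA ihB
  | arrowC _ _ ihA ihB => exact congrArg₂ _ ihA ihB
  | abs _ _ _ _ _ iht => exact congrArg _ iht
  | absC _ _ _ _ _ iht => exact congrArg _ iht
  | app _ _ iht ihu => exact congrArg₂ _ iht ihu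
  | appC _ _ iht ihl => exact congrArg₂ _ iht ihl

theorem Der.closed {t A : Term} (h : Der Φ ∅ [] (.term t A)) : t.Closed where
  subst _ _ := h.subst_eq ⟨nofun, nofun⟩
  lsubst _ := h.lsubst_eq (by simp)

/-! ### Inversion of derivations -/

namespace Der

theorem const_inv (hΦ : Φ.Regular) {Γ : Ctx} {c : Const} {A T : Term} (hc : Declares Φ c A)
    (h : Der Φ Ξ Γ (.term (.const c) T)) : Conv Φ A T := by
  generalize hJ : Judgment.term (.const c) T = J at h
  induction h generalizing T with
  | conv hT _ _ ih _ => cases hJ; exact (ih rfl).trans hT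
  | cons hc' _ => cases hJ; rw [hc.unique hΦ hc']; exact .refl _
  | _ => cases hJ

theorem pi_inv {Γ : Ctx} {A B T : Term} (h : Der Φ Ξ Γ (.term (.pi A B) T)) :
    Der Φ Ξ Γ (.term A (.sort .type)) ∧ ∃ s, Der Φ Ξ (.reg A :: Γ) (.term B (.sort s)) := by
  generalize hJ : Judgment.term (.pi A B) T = J at h
  induction h generalizing T with
  | conv _ _ _ ih _ => cases hJ; exact ih rfl
  | arrow hA hB => cases hJ; exact ⟨hA, _, hB⟩
  | _ => cases hJ

theorem piC_inv {Γ : Ctx} {A B T : Term} (h : Der Φ Ξ Γ (.term (.piC A B) T)) :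
    Der Φ Ξ Γ (.term A (.sort .type)) ∧ ∃ s, Der Φ Ξ (.conf A :: Γ) (.term B (.sort s)) := by
  generalize hJ : Judgment.term (.piC A B) T = J at h
  induction h generalizing T with
  | conv _ _ _ ih _ => cases hJ; exact ih rfl
  | arrowC hA hB => cases hJ; exact ⟨hA, _, hB⟩
  | _ => cases hJ

theorem lam_inv {Γ : Ctx} {t T : Term} (h : Der Φ Ξ Γ (.term (.lam t) T)) :
    ∃ A B, Der Φ Ξ Γ (.term A (.sort .type)) ∧ Der Φ Ξ (.reg A :: Γ) (.term t B) ∧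
      Conv Φ (.pi A B) T := by
  generalize hJ : Judgment.term (.lam t) T = J at h
  induction h generalizing T with
  | conv hT _ _ ih _ =>
    cases hJ
    obtain ⟨A, B, hA, ht, hAB⟩ := ih rfl
    exact ⟨A, B, hA, ht, hAB.trans hT⟩
  | abs hA _ ht => cases hJ; exact ⟨_, _, hA, ht, .refl _⟩
  | _ => cases hJ

theorem lamC_inv {Γ : Ctx} {t T : Term} (h : Der Φ Ξ Γ (.term (.lamC t) T)) :
    ∃ A B, Der Φ Ξ Γ (.term A (.sort .type)) ∧ Der Φ Ξ (.conf A :: Γ) (.term t B) ∧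
      Conv Φ (.piC A B) T := by
  generalize hJ : Judgment.term (.lamC t) T = J at h
  induction h generalizing T with
  | conv hT _ _ ih _ =>
    cases hJ
    obtain ⟨A, B, hA, ht, hAB⟩ := ih rfl
    exact ⟨A, B, hA, ht, hAB.trans hT⟩
  | absC hA _ ht => cases hJ; exact ⟨_, _, hA, ht, .refl _⟩
  | _ => cases hJ

theorem app_inv {Γ : Ctx} {t u T : Term} (h : Der Φ Ξ Γ (.term (.app t u) T)) :
    ∃ A B, Der Φ Ξ Γ (.term t (.pi A B)) ∧ Der Φ Ξ Γ (.term u A) ∧ Conv Φ (B.inst u) T := by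
  generalize hJ : Judgment.term (.app t u) T = J at h
  induction h generalizing T with
  | conv hT _ _ ih _ =>
    cases hJ
    obtain ⟨A, B, ht, hu, hB⟩ := ih rfl
    exact ⟨A, B, ht, hu, hB.trans hT⟩
  | app ht hu => cases hJ; exact ⟨_, _, ht, hu, .refl _⟩
  | _ => cases hJ

theorem appC_inv {Γ : Ctx} {t T : Term} {l : Level} (h : Der Φ Ξ Γ (.term (.appC t l) T)) :
    ∃ A B, Der Φ Ξ Γ (.term t (.piC A B)) ∧ Der Φ Ξ Γ (.level l A) ∧ Conv Φ (B.instC l) T := by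
  generalize hJ : Judgment.term (.appC t l) T = J at h
  induction h generalizing T with
  | conv hT _ _ ih _ =>
    cases hJ
    obtain ⟨A, B, ht, hu, hB⟩ := ih rfl
    exact ⟨A, B, ht, hu, hB.trans hT⟩
  | appC ht hu => cases hJ; exact ⟨_, _, ht, hu, .refl _⟩
  | _ => cases hJ

end Der

/-! ### Typing of the global constants -/

namespace Der

variable {Γ : Ctx}

theorem tTy {l : Level} (hl : Der Φ Ξ Γ (.level l tLvl)) :
    Der Φ Ξ Γ (.term (tTy l) (.sort .type)) :=
  .appC (B := .sort .type) (.cons (.glob .Ty) hl.wf) hl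

theorem tTm {l : Level} {A : Term} (hl : Der Φ Ξ Γ (.level l tLvl))
    (hA : Der Φ Ξ Γ (.term A (UPP.tTy l))) : Der Φ Ξ Γ (.term (tTm l A) (.sort .type)) :=
  .app (A := UPP.tTy l) (B := .sort .type)
    (.appC (B := .pi (UPP.tTy (.idx 0)) (.sort .type)) (.cons (.glob .Tm) hl.wf) hl) hA

theorem tmFamily (hΦ : Φ.Regular) {l l' : Level} {A : Term} (hl : Der Φ Ξ Γ (.level l tLvl))
    (hl' : Der Φ Ξ Γ (.level l' tLvl)) (hA : Der Φ Ξ Γ (.term A (UPP.tTy l))) :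
    Der Φ Ξ Γ (.term (.pi (UPP.tTm l A) (UPP.tTy l')) (.sort .type)) :=
  .arrow (tTm hl hA) (tTy (hl'.level_shift hΦ (tTm hl hA)))

theorem tmPi (hΦ : Φ.Regular) {l l' : Level} {A B : Term} (hl : Der Φ Ξ Γ (.level l tLvl))
    (hl' : Der Φ Ξ Γ (.level l' tLvl)) (hA : Der Φ Ξ Γ (.term A (UPP.tTy l)))
    (hB : Der Φ Ξ Γ (.term B (.pi (UPP.tTm l A) (UPP.tTy l')))) :
    Der Φ Ξ Γ (.term (.pi (UPP.tTm l A) (UPP.tTm l' (.app B.shift (.var 0)))) (.sort .type)) := by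
  have hT := tTm hl hA
  refine .arrow hT (tTm (hl'.level_shift hΦ hT) ?_)
  have hBx := Der.app (hB.shift hΦ hT) (.var (.here _ _) (.extCtx hT))
  simpa [Term.shift, Term.rename, UPP.tTy, Term.inst, Term.subst, Level.rename_id,
    Level.subst_idx] using hBx

theorem tPi {l l' : Level} {A B : Term} (hl : Der Φ Ξ Γ (.level l tLvl))
    (hl' : Der Φ Ξ Γ (.level l' tLvl)) (hA : Der Φ Ξ Γ (.term A (UPP.tTy l)))
    (hB : Der Φ Ξ Γ (.term B (.pi (UPP.tTm l A) (UPP.tTy l')))) :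
    Der Φ Ξ Γ (.term (tPi l l' A B) (UPP.tTy (.sup l l'))) := by
  have hPi_l := Der.appC (Γ := Γ) (.cons (Φ := Φ) (Ξ := Ξ) (.glob .Pi) hl.wf) hl
  have hPi_l_l' := Der.appC hPi_l hl'
  have hPi_l_l'_A := Der.app (A := UPP.tTy l) (B := .pi (.pi (UPP.tTm l (.var 0)) (UPP.tTy l'))
    (UPP.tTy (.sup l l'))) (u := A) (by
      simpa [Term.instC, Term.subst, Level.subst, upSubC, upSub, UPP.tTy, UPP.tTm,
        Level.subst_rename, Level.subst_idx, Term.shiftC, Term.rename] using hPi_l_l') hA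
  have hPi_l_l'_A_B := Der.app (A := .pi (UPP.tTm l A) (UPP.tTy l')) (B := UPP.tTy (.sup l l'))
    (u := B) (by
      simpa [Term.inst, Term.subst, Level.subst, upSub, UPP.tTy, UPP.tTm,
        Level.subst_idx] using hPi_l_l'_A) hB
  simpa [Term.inst, Term.subst, UPP.tTy, UPP.tPi, Level.subst_idx] using hPi_l_l'_A_B

end Der

/-- The context `l l' : Lvl, A : Ty l, B : Tm l A → Ty l'` of the arguments shared by `Π`, `λ` and
`@`. -/
def familyCtx : Ctx :=
  [.reg (.pi (tTm (.idx 1) (.var 0)) (tTy (.idx 0))), .reg (tTy (.idx 1)), .conf tLvl, .conf tLvl]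

/-- The product `(l l' : Lvl) → (A : Ty l) → (B : Tm l A → Ty l') → X` over `familyCtx`, the shape
of the types of `Π`, `λ` and `@`. -/
def familyPi (X : Term) : Term :=
  .piC tLvl (.piC tLvl (.pi (tTy (.idx 1))
    (.pi (.pi (tTm (.idx 1) (.var 0)) (tTy (.idx 0))) X)))

namespace Der

theorem familyPi {X : Term} {s : Srt} (hX : Der Φ Ξ familyCtx (.term X (.sort s))) :
    Der Φ Ξ [] (.term (familyPi X) (.sort s)) := by
  cases hX.wf with | extCtx hB =>
  cases hB.wf with | extCtx hA =>
  cases hA.wf with | extCtxC hl' =>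
  cases hl'.wf with | extCtxC hl =>
  exact .arrowC hl (.arrowC hl' (.arrow hA (.arrow hB hX)))

theorem familyCtx_wf (hΦ : Φ.Regular) : Der Φ Ξ familyCtx .wf := by
  have hll' : Der Φ Ξ [.conf tLvl, .conf tLvl] .wf :=
    .extCtxC (.lvl (.extCtxC (.lvl .emptyCtx)))
  have hA := Der.tTy (.varC (.conf _ (.here _ _)) hll')
  exact .extCtx (.tmFamily hΦ (.varC (.reg _ (.conf _ (.here _ _))) (.extCtx hA))
    (.varC (.reg _ (.here _ _)) (.extCtx hA)) (.var (.here _ _) (.extCtx hA)))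

theorem familyCtx_vars (hΦ : Φ.Regular) :
    Der Φ Ξ familyCtx (.level (.idx 1) tLvl) ∧ Der Φ Ξ familyCtx (.level (.idx 0) tLvl) ∧
      Der Φ Ξ familyCtx (.term (.var 1) (UPP.tTy (.idx 1))) ∧
      Der Φ Ξ familyCtx (.term (.var 0) (.pi (UPP.tTm (.idx 1) (.var 1)) (UPP.tTy (.idx 0)))) :=
  have hw := familyCtx_wf hΦ
  ⟨.varC (.reg _ (.reg _ (.conf _ (.here _ _)))) hw, .varC (.reg _ (.reg _ (.here _ _))) hw,
    .var (.reg _ (.here _ _)) hw, .var (.here _ _) hw⟩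

theorem lam_type (hΦ : Φ.Regular) : Der Φ Ξ [] (.term (Glob.type .Lam) (.sort .type)) := by
  obtain ⟨hl, hl', hA, hB⟩ := familyCtx_vars (Ξ := Ξ) hΦ
  have ht := Der.tmPi hΦ hl hl' hA hB
  exact .familyPi (.arrow ht ((Der.tTm (hl.sup hl') (.tPi hl hl' hA hB)).shift hΦ ht))

theorem app_type (hΦ : Φ.Regular) : Der Φ Ξ [] (.term (Glob.type .App) (.sort .type)) := by
  obtain ⟨hl, hl', hA, hB⟩ := familyCtx_vars (Ξ := Ξ) hΦ
  have ht := Der.tTm (hl.sup hl') (.tPi hl hl' hA hB)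
  have hu := (Der.tTm hl hA).shift hΦ ht
  have hBu := Der.app (A := UPP.tTm (.idx 1) (.var 3)) (B := UPP.tTy (.idx 0))
    ((hB.shift hΦ ht).shift hΦ hu) (.var (.here _ _) (.extCtx hu))
  exact .familyPi (.arrow ht (.arrow hu (.tTm ((hl'.level_shift hΦ ht).level_shift hΦ hu) hBu)))

end Der

theorem Glob.type_typed (hΦ : Φ.Regular) (g : Glob) :
    ∃ s, Der Φ Ξ [] (.term g.type (.sort s)) := by
  have hwf : Der Φ Ξ [.conf tLvl] .wf := .extCtxC (.lvl .emptyCtx)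
  have hTy : Der Φ Ξ [.conf tLvl] (.term (tTy (.idx 0)) (.sort .type)) :=
    .tTy (.varC (.here _ _) hwf)
  cases g with
  | Lvl => exact ⟨.kind, .sort .emptyCtx⟩
  | Ty => exact ⟨.kind, .arrowC (.lvl .emptyCtx) (.sort hwf)⟩
  | Tm => exact ⟨.kind, .arrowC (.lvl .emptyCtx) (.arrow hTy (.sort (.extCtx hTy)))⟩
  | U => exact ⟨.type, .arrowC (.lvl .emptyCtx) (.tTy (.succ (.varC (.here _ _) hwf)))⟩
  | Pi =>
    obtain ⟨hl, hl', -⟩ := Der.familyCtx_vars (Ξ := Ξ) hΦ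
    exact ⟨.type, .familyPi (.tTy (hl.sup hl'))⟩
  | Lam => exact ⟨.type, .lam_type hΦ⟩
  | App => exact ⟨.type, .app_type hΦ⟩

/-! ### Validity of signatures and of types -/

/-- The types of terms: `Kind`, which has no type itself, and the terms typed by a sort. -/
def IsType (Φ : LocalSig) (Ξ : Finset ℕ) (Γ : Ctx) (A : Term) : Prop :=
  A = .sort .kind ∨ ∃ s, Der Φ Ξ Γ (.term A (.sort s))

namespace IsType

theorem mono {Φ' : LocalSig} (hs : Φ ⊆ Φ') {Ξ' : Finset ℕ} (hΞ : Ξ ⊆ Ξ') {Γ : Ctx} {A : Term}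
    (h : IsType Φ Ξ Γ A) : IsType Φ' Ξ' Γ A :=
  h.imp_right fun ⟨s, hA⟩ => ⟨s, hA.mono hs hΞ⟩

theorem of_nil (hΦ : Φ.Regular) {Γ : Ctx} {A : Term} (h : IsType Φ Ξ [] A)
    (hw : Der Φ Ξ Γ .wf) : IsType Φ Ξ Γ A :=
  h.imp_right fun ⟨s, hA⟩ => ⟨s, hA.of_nil hΦ hw⟩

theorem closed {A : Term} (h : IsType Φ ∅ [] A) : A.Closed := by
  rcases h with rfl | ⟨s, hA⟩
  · exact ⟨fun _ _ => rfl, fun _ => rfl⟩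
  · exact hA.closed

theorem sort {Γ : Ctx} (s : Srt) (hw : Der Φ Ξ Γ .wf) : IsType Φ Ξ Γ (.sort s) := by
  cases s with
  | type => exact .inr ⟨.kind, .sort hw⟩
  | kind => exact .inl rfl

theorem inst (hΦ : Φ.Regular) {Γ : Ctx} {A B u : Term} (h : IsType Φ Ξ Γ (.pi A B))
    (hu : Der Φ Ξ Γ (.term u A)) : ∃ s, Der Φ Ξ Γ (.term (B.inst u) (.sort s)) := by
  obtain ⟨s, hAB⟩ := h.resolve_left nofun
  obtain ⟨-, s', hB⟩ := hAB.pi_inv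
  exact ⟨s', hB.inst hΦ hu⟩

theorem instC (hΦ : Φ.Regular) {Γ : Ctx} {A B : Term} {l : Level} (h : IsType Φ Ξ Γ (.piC A B))
    (hl : Der Φ Ξ Γ (.level l A)) : ∃ s, Der Φ Ξ Γ (.term (B.instC l) (.sort s)) := by
  obtain ⟨s, hAB⟩ := h.resolve_left nofun
  obtain ⟨-, s', hB⟩ := hAB.piC_inv
  exact ⟨s', hB.instC hΦ hl⟩

end IsType

/-- A regular local signature whose declarations are well-typed in the signature itself. -/
structure LocalSig.Valid (Φ : LocalSig) : Prop extends Φ.Regular where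
  isType : ∀ e ∈ Φ, IsType Φ ∅ [] e.type
  body_typed : ∀ e ∈ Φ, ∀ t, e.body = some t → Der Φ ∅ [] (.term t e.type)

theorem LocalSig.Valid.body_der (hΦ : Φ.Valid) {e : SigEntry} (he : e ∈ Φ) {t : Term}
    (ht : e.body = some t) {Γ : Ctx} (hw : Der Φ Ξ Γ .wf) : Der Φ Ξ Γ (.term t e.type) :=
  ((hΦ.body_typed e he t ht).mono (List.Subset.refl Φ) (Finset.empty_subset Ξ)).of_nil
    hΦ.toRegular hw

theorem Declares.isType (hΦ : Φ.Valid) {c : Const} {A : Term} (hc : Declares Φ c A) {Γ : Ctx}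
    (hw : Der Φ Ξ Γ .wf) : IsType Φ Ξ Γ A := by
  cases hc with
  | glob g => exact .of_nil hΦ.toRegular (.inr (g.type_typed hΦ.toRegular)) hw
  | loc he =>
    exact ((hΦ.isType _ he).mono (List.Subset.refl Φ) (Finset.empty_subset Ξ)).of_nil
      hΦ.toRegular hw

theorem Ctx.HasVar.typed (hΦ : Φ.Regular) {Γ : Ctx} {n : ℕ} {A : Term} (hn : Ctx.HasVar Γ n A)
    (hw : Der Φ Ξ Γ .wf) : Der Φ Ξ Γ (.term A (.sort .type)) := by
  induction hn with
  | here Γ A => cases hw with | extCtx hA => exact hA.shift hΦ hA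
  | reg B _ ih => cases hw with | extCtx hB => exact (ih hB.wf).shift hΦ hB
  | conf B _ ih => cases hw with | extCtxC hB => exact (ih hB.wf).shiftC hΦ hB

theorem Der.isType (hΦ : Φ.Valid) {Γ : Ctx} {t A : Term} (h : Der Φ Ξ Γ (.term t A)) :
    IsType Φ Ξ Γ A := by
  generalize hJ : Judgment.term t A = J at h
  induction h generalizing t A with
  | sort => cases hJ; exact .inl rfl
  | var hn hw => cases hJ; exact .inr ⟨_, hn.typed hΦ.toRegular hw⟩
  | cons hc hw => cases hJ; exact hc.isType hΦ hw
  | conv _ _ hB => cases hJ; exact .inr ⟨_, hB⟩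
  | arrow hA _ => cases hJ; exact .sort _ hA.wf
  | arrowC hA _ => cases hJ; exact .sort _ hA.wf
  | abs hA hB => cases hJ; exact .inr ⟨_, .arrow hA hB⟩
  | absC hA hB => cases hJ; exact .inr ⟨_, .arrowC hA hB⟩
  | app _ hu ih => cases hJ; exact .inr ((ih rfl).inst hΦ.toRegular hu)
  | appC _ hl ih => cases hJ; exact .inr ((ih rfl).instC hΦ.toRegular hl)
  | _ => cases hJ

theorem LocalSig.Regular.cons (hΦ : Φ.Regular) {e : SigEntry}
    (hnew : ∀ e' ∈ Φ, e'.name ≠ e.name) (htype : e.type.Closed)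
    (hbody : ∀ t, e.body = some t → t.Closed) : LocalSig.Regular (e :: Φ) where
  type_closed := List.forall_mem_cons.2 ⟨htype, hΦ.type_closed⟩
  body_closed := List.forall_mem_cons.2 ⟨hbody, hΦ.body_closed⟩
  unique := by
    simp only [List.mem_cons]
    rintro e₁ (rfl | he₁) e₂ (rfl | he₂) hn
    · rfl
    · exact absurd hn.symm (hnew _ he₂)
    · exact absurd hn (hnew _ he₁)
    · exact hΦ.unique _ he₁ _ he₂ hn

theorem LocalSig.Valid.cons (hΦ : Φ.Valid) {e : SigEntry} (hnew : ∀ e' ∈ Φ, e'.name ≠ e.name)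
    (htype : IsType Φ ∅ [] e.type)
    (hbody : ∀ t, e.body = some t → Der Φ ∅ [] (.term t e.type)) : LocalSig.Valid (e :: Φ) where
  toRegular := hΦ.toRegular.cons hnew htype.closed fun t ht => (hbody t ht).closed
  isType e' he' := by
    refine IsType.mono (List.subset_cons_self e Φ) (subset_refl ∅) ?_
    exact List.forall_mem_cons (p := fun e => IsType Φ ∅ [] e.type).2 ⟨htype, hΦ.isType⟩ e' he'
  body_typed e' he' t ht := by
    refine Der.mono (List.subset_cons_self e Φ) (subset_refl ∅) ?_
    exact List.forall_mem_cons (p := fun e => ∀ t, e.body = some t → Der Φ ∅ [] (.term t e.type)).2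
      ⟨hbody, hΦ.body_typed⟩ e' he' t ht

theorem LocalSig.WellFormed.valid (h : Φ.WellFormed) : Φ.Valid := by
  induction h with
  | nil => exact ⟨⟨by simp, by simp, by simp⟩, by simp, by simp⟩
  | decl _ hnew hA ih => exact ih.cons hnew (.inr ⟨_, hA⟩) nofun
  | defn _ hnew ht ih =>
    exact ih.cons hnew (ht.isType ih) fun t' ht' => by cases ht'; exact ht

/-! ### Subject reduction -/

/-- Every type of `t` is convertible to `T`; neither a type of `t` nor the typability of `T` is
required to exist, so that head symbols can be applied to arguments before these are checked. -/
def IsPrincipalType (Φ : LocalSig) (Ξ : Finset ℕ) (Γ : Ctx) (t T : Term) : Prop :=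
  ∀ ⦃T'⦄, Der Φ Ξ Γ (.term t T') → Conv Φ T T'

namespace IsPrincipalType

variable {Γ : Ctx}

theorem const (hΦ : Φ.Regular) {c : Const} {A : Term} (hc : Declares Φ c A) :
    IsPrincipalType Φ Ξ Γ (.const c) A :=
  fun _ h => h.const_inv hΦ hc

theorem app (hΦ : Φ.Regular) {f A B : Term} (hf : IsPrincipalType Φ Ξ Γ f (.pi A B)) (u : Term) :
    IsPrincipalType Φ Ξ Γ (.app f u) (B.inst u) := fun _ h => by
  obtain ⟨_, _, hf', -, hT⟩ := h.app_inv
  exact (((hf hf').pi_inj hΦ).2.inst hΦ u).trans hT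

theorem appC (hΦ : Φ.Regular) {f A B : Term} (hf : IsPrincipalType Φ Ξ Γ f (.piC A B))
    (l : Level) : IsPrincipalType Φ Ξ Γ (.appC f l) (B.instC l) := fun _ h => by
  obtain ⟨_, _, hf', -, hT⟩ := h.appC_inv
  exact (((hf hf').piC_inj hΦ).2.instC hΦ l).trans hT

theorem arg_typed (hΦ : Φ.Regular) {f u A B T : Term} {s : Srt}
    (hf : IsPrincipalType Φ Ξ Γ f (.pi A B)) (h : Der Φ Ξ Γ (.term (.app f u) T))
    (hA : Der Φ Ξ Γ (.term A (.sort s))) : Der Φ Ξ Γ (.term u A) := by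
  obtain ⟨_, _, hf', hu, -⟩ := h.app_inv
  exact .conv ((hf hf').pi_inj hΦ).1.symm hu hA

theorem argC_typed (hΦ : Φ.Regular) {f A B T : Term} {l : Level}
    (hf : IsPrincipalType Φ Ξ Γ f (.piC A B)) (h : Der Φ Ξ Γ (.term (.appC f l) T))
    (hA : Der Φ Ξ Γ (.term A (.sort .type))) : Der Φ Ξ Γ (.level l A) := by
  obtain ⟨_, _, hf', hl, -⟩ := h.appC_inv
  exact .convC ((hf hf').piC_inj hΦ).1.symm hl hA

end IsPrincipalType

/-- `c l l' A B`, the application of a global constant to the arguments shared by `Π`, `λ` and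
`@`. -/
def familyApp (c : Glob) (l l' : Level) (A B : Term) : Term :=
  .app (.app (.appC (.appC (.const (.glob c)) l) l') A) B

/-- The instantiation of the regular variables of `familyCtx`. -/
def familySub (A B : Term) : ℕ → Term
  | 0 => B
  | 1 => A
  | n + 2 => .var n

/-- The instantiation of the confined variables of `familyCtx`. -/
def familySubC (l l' : Level) : ℕ → Level
  | 0 => l'
  | 1 => l
  | n + 2 => .idx n

theorem subst_instSub_familySub (A B X : Term) (τ : ℕ → Level) :
    (X.subst (upSub (instSub A)) τ).subst (instSub B) .idx = X.subst (familySub A B) τ := by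
  simp only [Term.subst_subst, Level.subst_idx]
  congr 1
  funext n
  match n with
  | 0 => rfl
  | 1 => exact Term.subst_instSub_shift A B
  | n + 2 => rfl

theorem subst_instSubC_familySubC (l l' : Level) (X : Term) :
    (X.subst .var (upSubC (instSubC l))).subst .var (instSubC l') =
      X.subst .var (familySubC l l') := by
  simp only [Term.subst_subst]
  congr 1
  funext n
  match n with
  | 0 => rfl
  | 1 => exact (Level.subst_rename ..).trans (Level.subst_idx l)
  | n + 2 => rfl

namespace IsPrincipalType

variable {Γ : Ctx}

theorem familyApp_levels (hΦ : Φ.Regular) {c : Glob} {X : Term} (hc : c.type = familyPi X)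
    (l l' : Level) :
    IsPrincipalType Φ Ξ Γ (.appC (.appC (.const (.glob c)) l) l')
      (.pi (tTy l) (.pi (.pi (tTm l (.var 0)) (tTy l'))
        (X.subst .var (familySubC l l')))) := by
  have hdecl : Declares Φ (.glob c) (familyPi X) := hc ▸ Declares.glob c
  have h : IsPrincipalType Φ Ξ Γ _
      (Term.subst .var (instSubC l') (Term.subst .var (upSubC (instSubC l)) _)) :=
    ((const hΦ hdecl).appC hΦ l).appC hΦ l'
  rw [subst_instSubC_familySubC] at h
  simpa only [Term.subst, Level.subst, upSub_var, familySubC, tTy, tTm] using h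

theorem familyApp_dom (hΦ : Φ.Regular) {c : Glob} {X : Term} (hc : c.type = familyPi X)
    (l l' : Level) (A : Term) :
    IsPrincipalType Φ Ξ Γ (.app (.appC (.appC (.const (.glob c)) l) l') A)
      (.pi (.pi (tTm l A) (tTy l')) (X.subst (upSub (instSub A)) (familySubC l l'))) := by
  have h : IsPrincipalType Φ Ξ Γ _ (Term.subst (instSub A) .idx _) :=
    (familyApp_levels hΦ hc l l').app hΦ A
  simpa only [Term.subst, instSub, tTm, tTy, Level.subst_idx, Term.subst_subst] using h

theorem familyApp (hΦ : Φ.Regular) {c : Glob} {X : Term} (hc : c.type = familyPi X)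
    (l l' : Level) (A B : Term) :
    IsPrincipalType Φ Ξ Γ (familyApp c l l' A B)
      (X.subst (familySub A B) (familySubC l l')) := by
  have h := (familyApp_dom (Ξ := Ξ) (Γ := Γ) hΦ hc l l' A).app hΦ B
  rwa [← subst_instSub_familySub]

end IsPrincipalType

theorem Der.familyApp_args (hΦ : Φ.Regular) {c : Glob} {X : Term} (hc : c.type = UPP.familyPi X)
    {Γ : Ctx} {l l' : Level} {A B T : Term} (h : Der Φ Ξ Γ (.term (familyApp c l l' A B) T)) :
    Der Φ Ξ Γ (.level l tLvl) ∧ Der Φ Ξ Γ (.level l' tLvl) ∧ Der Φ Ξ Γ (.term A (UPP.tTy l)) ∧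
      Der Φ Ξ Γ (.term B (.pi (UPP.tTm l A) (UPP.tTy l'))) := by
  have hdecl : Declares Φ (.glob c) (UPP.familyPi X) := hc ▸ Declares.glob c
  obtain ⟨_, _, hA', -, -⟩ := h.app_inv
  obtain ⟨_, _, hl'', -, -⟩ := hA'.app_inv
  obtain ⟨_, _, hl, -, -⟩ := hl''.appC_inv
  have hl := (IsPrincipalType.const hΦ hdecl).argC_typed hΦ hl hl.wf.lvl
  have hl' : Der Φ Ξ Γ (.level l' tLvl) :=
    ((IsPrincipalType.const hΦ hdecl).appC hΦ l).argC_typed hΦ hl'' hl.wf.lvl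
  have hA := (IsPrincipalType.familyApp_levels hΦ hc l l').arg_typed hΦ hA' hl.tTy
  exact ⟨hl, hl', hA, (IsPrincipalType.familyApp_dom hΦ hc l l' A).arg_typed hΦ h
    (.tmFamily hΦ hl hl' hA)⟩

namespace IsPrincipalType

variable {Γ : Ctx}

theorem lamFamily (hΦ : Φ.Regular) (l l' : Level) (A B : Term) :
    IsPrincipalType Φ Ξ Γ (UPP.familyApp .Lam l l' A B)
      (.pi (.pi (tTm l A) (tTm l' (.app B.shift (.var 0))))
        (tTm (.sup l l') (tPi l l' A.shift B.shift))) :=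
  familyApp (c := .Lam) hΦ rfl l l' A B

theorem appFamily (hΦ : Φ.Regular) (l l' : Level) (A B : Term) :
    IsPrincipalType Φ Ξ Γ (UPP.familyApp .App l l' A B)
      (.pi (tTm (.sup l l') (tPi l l' A B))
        (.pi (tTm l A.shift) (tTm l' (.app B.shift.shift (.var 0))))) :=
  familyApp (c := .App) hΦ rfl l l' A B

theorem tLam (hΦ : Φ.Regular) (l l' : Level) (A B t : Term) :
    IsPrincipalType Φ Ξ Γ (tLam l l' A B t) (tTm (.sup l l') (tPi l l' A B)) := by
  have h : IsPrincipalType Φ Ξ Γ (UPP.tLam l l' A B t) (Term.subst (instSub t) .idx _) :=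
    (lamFamily hΦ l l' A B).app hΦ t
  simpa only [tTm, tPi, Term.subst, Level.subst_idx, Term.subst_instSub_shift] using h

theorem appFamily_app (hΦ : Φ.Regular) (l l' : Level) (A B t : Term) :
    IsPrincipalType Φ Ξ Γ (.app (UPP.familyApp .App l l' A B) t)
      (.pi (tTm l A) (tTm l' (.app B.shift (.var 0)))) := by
  have h : IsPrincipalType Φ Ξ Γ _ (Term.subst (instSub t) .idx _) :=
    (appFamily hΦ l l' A B).app hΦ t
  simpa only [tTm, tPi, Term.subst, Level.subst_idx, Term.subst_shift, Term.subst_instSub_shift,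
    upSub] using h

end IsPrincipalType

theorem tTm_app_shift_inst (l : Level) (B u : Term) :
    (tTm l (.app B.shift (.var 0))).inst u = tTm l (.app B u) := by
  change Term.subst (instSub u) .idx _ = _
  simp only [tTm, Term.subst, Level.subst_idx, Term.subst_instSub_shift, instSub]

namespace Der

variable {Γ : Ctx}

theorem contract_beta (hΦ : Φ.Regular) {t u T : Term}
    (h : Der Φ Ξ Γ (.term (.app (.lam t) u) T)) :
    ∃ T', Der Φ Ξ Γ (.term (t.inst u) T') ∧ Conv Φ T' T := by
  obtain ⟨A, B, ht, hu, hT⟩ := h.app_inv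
  obtain ⟨A', B', hA', ht, hAB⟩ := ht.lam_inv
  obtain ⟨hA, hB⟩ := hAB.pi_inj hΦ
  exact ⟨_, ht.inst hΦ (.conv hA.symm hu hA'), (hB.inst hΦ u).trans hT⟩

theorem contract_betaC (hΦ : Φ.Regular) {t T : Term} {l : Level}
    (h : Der Φ Ξ Γ (.term (.appC (.lamC t) l) T)) :
    ∃ T', Der Φ Ξ Γ (.term (t.instC l) T') ∧ Conv Φ T' T := by
  obtain ⟨A, B, ht, hl, hT⟩ := h.appC_inv
  obtain ⟨A', B', hA', ht, hAB⟩ := ht.lamC_inv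
  obtain ⟨hA, hB⟩ := hAB.piC_inj hΦ
  exact ⟨_, ht.instC hΦ (.convC hA.symm hl hA'), (hB.instC hΦ l).trans hT⟩

theorem contract_tmU (hΦ : Φ.Regular) {l' l : Level} {T : Term}
    (h : Der Φ Ξ Γ (.term (UPP.tTm l' (tU l)) T)) :
    ∃ T', Der Φ Ξ Γ (.term (UPP.tTy l) T') ∧ Conv Φ T' T := by
  have hTm := (IsPrincipalType.const (Ξ := Ξ) (Γ := Γ) hΦ (.glob .Tm)).appC hΦ l'
  obtain ⟨_, _, -, hU, -⟩ := h.app_inv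
  have hl := (IsPrincipalType.const hΦ (.glob .U)).argC_typed hΦ hU h.wf.lvl
  exact ⟨_, tTy hl, hTm.app hΦ _ h⟩

theorem contract_appLam (hΦ : Φ.Regular) {l l' m m' : Level} {A B A' B' t u T : Term}
    (h : Der Φ Ξ Γ (.term (tApp l l' A B (tLam m m' A' B' t) u) T)) :
    ∃ T', Der Φ Ξ Γ (.term (.app t u) T') ∧ Conv Φ T' T := by
  obtain ⟨_, _, hf, -, -⟩ := h.app_inv
  obtain ⟨_, _, hf', hlam, -⟩ := hf.app_inv
  obtain ⟨_, _, hlamFamily, -, -⟩ := hlam.app_inv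
  obtain ⟨hl, hl', hA, hB⟩ := familyApp_args (c := .App) hΦ rfl hf'
  obtain ⟨hm, hm', hA', hB'⟩ := familyApp_args (c := .Lam) hΦ rfl hlamFamily
  have hfun := IsPrincipalType.appFamily_app (Ξ := Ξ) (Γ := Γ) hΦ l l' A B (tLam m m' A' B' t)
  have hw := (IsPrincipalType.appFamily hΦ l l' A B).arg_typed hΦ hf
    (tTm (hl.sup hl') (tPi hl hl' hA hB))
  obtain ⟨elm, elm', eA, eB⟩ := (IsPrincipalType.tLam hΦ m m' A' B' t hw).tTm_tPi_inj hΦ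
  have ht := (IsPrincipalType.lamFamily hΦ m m' A' B').arg_typed hΦ hlam (tmPi hΦ hm hm' hA' hB')
  have hu : Der Φ Ξ Γ (.term u (UPP.tTm m A')) :=
    .conv (.app (.appC (.refl _) elm.symm) eA.symm) (hfun.arg_typed hΦ h (tTm hl hA)) (tTm hm hA')
  have htu := Der.app ht hu
  have hT := hfun.app hΦ u h
  rw [tTm_app_shift_inst] at htu hT
  exact ⟨_, htu, .trans (.app (.appC (.refl _) elm') (.app eB (.refl _))) hT⟩

theorem contract (hΦ : Φ.Valid) {t t' T : Term} (hc : Contracts Φ t t')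
    (h : Der Φ Ξ Γ (.term t T)) : ∃ T', Der Φ Ξ Γ (.term t' T') ∧ Conv Φ T' T := by
  cases hc with
  | beta => exact contract_beta hΦ.toRegular h
  | betaC => exact contract_betaC hΦ.toRegular h
  | delta he ht => exact ⟨_, hΦ.body_der he ht h.wf, h.const_inv hΦ.toRegular (.loc he)⟩
  | tmU => exact contract_tmU hΦ.toRegular h
  | appLam => exact contract_appLam hΦ.toRegular h

theorem step_const (hΦ : Φ.Valid) {c : Const} {t' A : Term} (hc : Declares Φ c A)
    (hw : Der Φ Ξ Γ .wf) (ht : Step Φ (.const c) t') : Der Φ Ξ Γ (.term t' A) := by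
  cases ht with | root hr => cases hr with | delta he ht =>
  cases hc.unique hΦ.toRegular (.loc he)
  exact hΦ.body_der he ht hw

theorem step_pi (hΦ : Φ.Regular) {A B t' : Term} {s : Srt}
    (hA : Der Φ Ξ Γ (.term A (.sort .type))) (hB : Der Φ Ξ (.reg A :: Γ) (.term B (.sort s)))
    (ihA : ∀ {A'}, Step Φ A A' → Der Φ Ξ Γ (.term A' (.sort .type)))
    (ihB : ∀ {B'}, Step Φ B B' → Der Φ Ξ (.reg A :: Γ) (.term B' (.sort s)))
    (ht : Step Φ (.pi A B) t') : Der Φ Ξ Γ (.term t' (.sort s)) := by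
  cases ht with
  | root hc => cases hc
  | pi_dom _ hs => exact .arrow (ihA hs) (hB.conv_ctx hΦ (.of_step hs) hA (ihA hs))
  | pi_cod _ hs => exact .arrow hA (ihB hs)

theorem step_piC (hΦ : Φ.Regular) {A B t' : Term} {s : Srt}
    (hA : Der Φ Ξ Γ (.term A (.sort .type))) (hB : Der Φ Ξ (.conf A :: Γ) (.term B (.sort s)))
    (ihA : ∀ {A'}, Step Φ A A' → Der Φ Ξ Γ (.term A' (.sort .type)))
    (ihB : ∀ {B'}, Step Φ B B' → Der Φ Ξ (.conf A :: Γ) (.term B' (.sort s)))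
    (ht : Step Φ (.piC A B) t') : Der Φ Ξ Γ (.term t' (.sort s)) := by
  cases ht with
  | root hc => cases hc
  | piC_dom _ hs => exact .arrowC (ihA hs) (hB.conv_ctxC hΦ (.of_step hs) hA (ihA hs))
  | piC_cod _ hs => exact .arrowC hA (ihB hs)

theorem step_app (hΦ : Φ.Valid) {f u A B t' : Term} (hf : Der Φ Ξ Γ (.term f (.pi A B)))
    (hu : Der Φ Ξ Γ (.term u A)) (ihf : ∀ {f'}, Step Φ f f' → Der Φ Ξ Γ (.term f' (.pi A B)))
    (ihu : ∀ {u'}, Step Φ u u' → Der Φ Ξ Γ (.term u' A)) (ht : Step Φ (.app f u) t') :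
    Der Φ Ξ Γ (.term t' (B.inst u)) := by
  obtain ⟨s, hB⟩ := (hf.isType hΦ).inst hΦ.toRegular hu
  cases ht with
  | root hc =>
    obtain ⟨T, ht', hT⟩ := contract hΦ hc (.app hf hu)
    exact .conv hT ht' hB
  | app_fun _ hs => exact .app (ihf hs) hu
  | app_arg _ hs =>
    exact .conv (.symm (.of_par ((Par.refl _).inst hΦ.toRegular hs.par))) (.app hf (ihu hs)) hB

theorem step_appC (hΦ : Φ.Valid) {f A B t' : Term} {l : Level}
    (hf : Der Φ Ξ Γ (.term f (.piC A B))) (hl : Der Φ Ξ Γ (.level l A))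
    (ihf : ∀ {f'}, Step Φ f f' → Der Φ Ξ Γ (.term f' (.piC A B))) (ht : Step Φ (.appC f l) t') :
    Der Φ Ξ Γ (.term t' (B.instC l)) := by
  obtain ⟨s, hB⟩ := (hf.isType hΦ).instC hΦ.toRegular hl
  cases ht with
  | root hc =>
    obtain ⟨T, ht', hT⟩ := contract hΦ hc (.appC hf hl)
    exact .conv hT ht' hB
  | appC _ hs => exact .appC (ihf hs) hl

theorem step (hΦ : Φ.Valid) {t t' A : Term} (h : Der Φ Ξ Γ (.term t A)) (ht : Step Φ t t') :
    Der Φ Ξ Γ (.term t' A) := by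
  generalize hJ : Judgment.term t A = J at h
  induction h generalizing t t' A with
  | sort => cases hJ; cases ht with | root hc => cases hc
  | var => cases hJ; cases ht with | root hc => cases hc
  | cons hc hw => cases hJ; exact step_const hΦ hc hw ht
  | conv hAB _ hB ih => cases hJ; exact .conv hAB (ih ht rfl) hB
  | arrow hA hB ihA ihB =>
    cases hJ
    exact step_pi hΦ.toRegular hA hB (fun hs => ihA hs rfl) (fun hs => ihB hs rfl) ht
  | arrowC hA hB ihA ihB =>
    cases hJ
    exact step_piC hΦ.toRegular hA hB (fun hs => ihA hs rfl) (fun hs => ihB hs rfl) ht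
  | abs hA hB _ _ _ iht =>
    cases hJ
    cases ht with
    | root hc => cases hc
    | lam hs => exact .abs hA hB (iht hs rfl)
  | absC hA hB _ _ _ iht =>
    cases hJ
    cases ht with
    | root hc => cases hc
    | lamC hs => exact .absC hA hB (iht hs rfl)
  | app hf hu ihf ihu =>
    cases hJ
    exact step_app hΦ hf hu (fun hs => ihf hs rfl) (fun hs => ihu hs rfl) ht
  | appC hf hl ihf => cases hJ; exact step_appC hΦ hf hl (fun hs => ihf hs rfl) ht
  | _ => cases hJ

theorem red (hΦ : Φ.Valid) {t t' A : Term} (h : Der Φ Ξ Γ (.term t A)) (ht : Red Φ t t') :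
    Der Φ Ξ Γ (.term t' A) := by
  induction ht with
  | refl => exact h
  | tail _ hs ih => exact ih.step hΦ hs

end Der

/-! ### Level substitutions -/

theorem Contracts.lsubst (hΦ : Φ.Regular) (θ : LevelSubst) {t u : Term} (h : Contracts Φ t u) :
    Contracts Φ (t.lsubst θ) (u.lsubst θ) := by
  cases h with
  | beta t u => rw [Term.lsubst_inst]; exact .beta _ _
  | betaC t l => rw [Term.lsubst_instC]; exact .betaC _ _
  | delta he ht => rw [(hΦ.body_closed _ he _ ht).lsubst]; exact .delta he ht
  | tmU l' l => exact .tmU _ _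
  | appLam => exact .appLam _ _ _ _ _ _ _ _ _ _

theorem Step.lsubst (hΦ : Φ.Regular) (θ : LevelSubst) {t u : Term} (h : Step Φ t u) :
    Step Φ (t.lsubst θ) (u.lsubst θ) := by
  induction h with
  | root h => exact .root (h.lsubst hΦ θ)
  | pi_dom B _ ih => exact .pi_dom _ ih
  | pi_cod A _ ih => exact .pi_cod _ ih
  | lam _ ih => exact .lam ih
  | app_fun u _ ih => exact .app_fun _ ih
  | app_arg t _ ih => exact .app_arg _ ih
  | piC_dom B _ ih => exact .piC_dom _ ih
  | piC_cod A _ ih => exact .piC_cod _ ih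
  | lamC _ ih => exact .lamC ih
  | appC l _ ih => exact .appC _ ih

theorem Red.lsubst (hΦ : Φ.Regular) (θ : LevelSubst) {t u : Term} (h : Red Φ t u) :
    Red Φ (t.lsubst θ) (u.lsubst θ) :=
  Relation.ReflTransGen.lift (Term.lsubst θ) (fun _ _ hs => Step.lsubst hΦ θ hs) _ _ h

theorem LevelSubst.Satisfies.mono {θ : LevelSubst} {C C' : Set Constraint}
    (h : θ.Satisfies C') (hC : C ⊆ C') : θ.Satisfies C := fun e he => h e (hC he)

theorem ConvC.conv (hΦ : Φ.Regular) {θ : LevelSubst} {m : ConvMode} {A B : Term}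
    {C : Set Constraint} (h : ConvC Φ m A B C) (hθ : θ.Satisfies C) :
    Conv Φ (A.lsubst θ) (B.lsubst θ) := by
  induction h with
  | reduce hA hB _ ih =>
    exact (Conv.of_red (hA.1.lsubst hΦ θ)).trans
      ((ih hθ).trans (Conv.of_red (hB.1.lsubst hΦ θ)).symm)
  | var n => exact .refl _
  | const c => exact .refl _
  | sort s => exact .refl _
  | lam _ ih => exact (ih hθ).lam
  | pi _ _ ihA ihB =>
    exact (ihA (hθ.mono Set.subset_union_left)).pi (ihB (hθ.mono Set.subset_union_right))
  | app _ _ iht ihu =>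
    exact (iht (hθ.mono Set.subset_union_left)).app (ihu (hθ.mono Set.subset_union_right))
  | appC l l' _ ih =>
    exact (ih (hθ.mono Set.subset_union_left)).appC (hθ (l, l') (.inr rfl))

theorem Ctx.HasVar.lsubst (θ : LevelSubst) {Γ : Ctx} {n : ℕ} {A : Term} (h : Γ.HasVar n A) :
    (Γ.lsubst θ).HasVar n (A.lsubst θ) := by
  induction h with
  | here Γ A => rw [Term.shift, Term.lsubst_rename]; exact .here _ _
  | reg B _ ih => rw [Term.shift, Term.lsubst_rename]; exact .reg _ ih
  | conf B _ ih => rw [Term.shiftC, Term.lsubst_rename]; exact .conf _ ih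

theorem Level.IdxFree.typed {l : Level} (hl : l.IdxFree) (hΞ : l.names ⊆ Ξ) {Γ : Ctx}
    (hw : Der Φ Ξ Γ .wf) : Der Φ Ξ Γ (.level l tLvl) := by
  induction l with
  | name i => exact .varΞ (hΞ (Finset.mem_singleton_self i)) hw
  | idx n => exact hl.elim
  | zero => exact .zero hw
  | succ l ih => exact .succ (ih hl hΞ)
  | sup l l' ih ih' =>
    exact .sup (ih hl.1 (Finset.union_subset_left hΞ)) (ih' hl.2 (Finset.union_subset_right hΞ))

theorem LevelSubst.typed {V : Finset ℕ} {θ : LevelSubst} {i : ℕ} (hi : i ∈ V) {Γ : Ctx}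
    (hw : Der Φ (levelCtx V θ) Γ .wf) : Der Φ (levelCtx V θ) Γ (.level (θ.toFun i) tLvl) :=
  (θ.idxFree i).typed (Finset.subset_biUnion_of_mem (fun i => (θ.toFun i).names) hi) hw

/-! ### Schematic constants -/

/-- `t l₁ … lₖ`, the application of `t` to a list of levels. -/
def Term.appLevels (t : Term) (ls : List Level) : Term :=
  ls.foldl .appC t

/-- `B[j₁ ↦ l₁, …, jₖ ↦ lₖ]`, where `j₁, …, jₖ` are the last confined variables of the scope of `B`
(`jₖ` being the last one).  This is meaningful for levels without de Bruijn indices only, since the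
`lₘ` are not shifted. -/
def Term.instLevels (B : Term) (ls : List Level) : Term :=
  ls.foldr (fun l B => B.instC l) B

theorem Term.lsubst_appNames (θ : LevelSubst) (t : Term) (is : List ℕ) :
    (t.appNames is).lsubst θ = (t.lsubst θ).appLevels (is.map θ.toFun) := by
  induction is generalizing t with
  | nil => rfl
  | cons i _ ih => exact ih _

theorem Term.lsubst_instNames (θ : LevelSubst) (B : Term) (is : List ℕ) :
    (B.instNames is).lsubst θ = (B.lsubst θ).instLevels (is.map θ.toFun) := by
  induction is with
  | nil => rfl
  | cons i is ih => exact (lsubst_instC θ _ _).trans (congrArg (instC · (θ.toFun i)) ih)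

theorem Term.names_appNames (t : Term) (is : List ℕ) :
    (t.appNames is).names = t.names ∪ is.toFinset := by
  induction is generalizing t with
  | nil => simp [appNames]
  | cons i is ih =>
    rw [appNames, List.foldl_cons, ← appNames, ih, List.toFinset_cons, Finset.insert_eq,
      ← Finset.union_assoc]
    rfl

theorem lsubst_piLvls (θ : LevelSubst) (k : ℕ) (B : Term) :
    (piLvls k B).lsubst θ = piLvls k (B.lsubst θ) := by
  induction k with
  | zero => rfl
  | succ k ih => exact congrArg _ ih

theorem subst_piLvls (k : ℕ) (B : Term) (τ : ℕ → Level) :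
    (piLvls k B).subst .var τ = piLvls k (B.subst .var (upSubC^[k] τ)) := by
  induction k generalizing τ with
  | zero => rfl
  | succ k ih => exact congrArg _ (ih _)

theorem Term.subst_instLevels {ls : List Level} (hls : ∀ l ∈ ls, l.IdxFree) (B : Term)
    (τ : ℕ → Level) :
    (B.instLevels ls).subst .var τ = (B.subst .var (upSubC^[ls.length] τ)).instLevels ls := by
  induction ls generalizing τ with
  | nil => rfl
  | cons l ls ih =>
    obtain ⟨hl, hls⟩ := List.forall_mem_cons.1 hls
    calc (instC (B.instLevels ls) l).subst .var τ
        = ((B.instLevels ls).subst .var (upSubC τ)).instC (l.subst τ) := subst_instC ..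
      _ = _ := by rw [ih hls, hl.subst_eq]; rfl

theorem Der.appLevels {Γ : Ctx} {ls : List Level} (hls : ∀ l ∈ ls, l.IdxFree)
    (hl : ∀ l ∈ ls, Der Φ Ξ Γ (.level l tLvl)) {t B : Term}
    (ht : Der Φ Ξ Γ (.term t (piLvls ls.length B))) :
    Der Φ Ξ Γ (.term (t.appLevels ls) (B.instLevels ls)) := by
  induction ls generalizing t B with
  | nil => exact ht
  | cons l ls ih =>
    obtain ⟨-, hls⟩ := List.forall_mem_cons.1 hls
    obtain ⟨hl, hl'⟩ := List.forall_mem_cons.1 hl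
    have happ := Der.appC ht hl
    rw [Term.instC, subst_piLvls] at happ
    have hrest := ih hls hl' happ
    rwa [← Term.subst_instLevels hls] at hrest

theorem Declares.appNames_typed (hΦ : Φ.Regular) {c : Const} {B : Term} {is : List ℕ}
    (hc : Declares Φ c (piLvls is.length B)) {V : Finset ℕ} (his : ∀ i ∈ is, i ∈ V)
    {θ : LevelSubst} {Γ : Ctx} (hw : Der Φ (levelCtx V θ) Γ .wf) :
    Der Φ (levelCtx V θ) Γ
      (.term ((Term.appNames (.const c) is).lsubst θ) ((B.instNames is).lsubst θ)) := by
  rw [Term.lsubst_appNames, Term.lsubst_instNames]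
  refine Der.appLevels (List.forall_mem_map.2 fun i _ => θ.idxFree i)
    (List.forall_mem_map.2 fun i hi => LevelSubst.typed (his i hi) hw) ?_
  rw [List.length_map, ← lsubst_piLvls, (hc.closed hΦ).lsubst θ]
  exact .cons hc hw

/-! ### Soundness of the bidirectional system -/

theorem Red.eq_sort {s : Srt} {t : Term} (h : Red Φ (.sort s) t) : t = .sort s := by
  induction h with
  | refl => rfl
  | tail _ hs ih => subst ih; cases hs with | root hc => cases hc

theorem Der.red_type (hΦ : Φ.Valid) {Γ : Ctx} {t A A' : Term} (h : Der Φ Ξ Γ (.term t A))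
    (hA : Red Φ A A') : Der Φ Ξ Γ (.term t A') := by
  rcases h.isType hΦ with rfl | ⟨s, hs⟩
  · rwa [hA.eq_sort]
  · exact .conv (.of_red hA) h (hs.red hΦ hA)

/-- What a bidirectional judgment with context `Γ` and type `A` presupposes: checking is relative to
a well-typed type, inference to a well-formed context only. -/
def Mode.Presupposition (Φ : LocalSig) (Ξ : Finset ℕ) (Γ : Ctx) (A : Term) : Mode → Prop
  | .check => ∃ s, Der Φ Ξ Γ (.term A (.sort s))
  | .infer => Der Φ Ξ Γ .wf

theorem Bidi.sound (hΦ : Φ.Valid) {V : Finset ℕ} {θ : LevelSubst} {m : Mode} {Γ : Ctx}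
    {D C : Set Constraint} {t A : Term} (h : Bidi Φ m Γ D t A C) (hθ : θ.Satisfies C)
    (ht : t.names ⊆ V)
    (hm : m.Presupposition Φ (levelCtx V θ) (Γ.lsubst θ) (A.lsubst θ)) :
    Der Φ (levelCtx V θ) (Γ.lsubst θ) (.term (t.lsubst θ) (A.lsubst θ)) := by
  induction h with
  | switch _ hAB ih =>
    obtain ⟨s, hB⟩ := hm
    exact .conv (hAB.conv hΦ.toRegular (hθ.mono Set.subset_union_right))
      (ih (hθ.mono Set.subset_union_left) ht hB.wf) hB
  | abs hT _ ih =>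
    obtain ⟨s, hs⟩ := hm
    have hT := hT.1.lsubst hΦ.toRegular θ
    obtain ⟨hA, s', hB⟩ := (hs.red hΦ hT).pi_inv
    exact .conv (Conv.of_red hT).symm (.abs hA hB (ih hθ ht ⟨s', hB⟩)) hs
  | var _ hn => exact .var (hn.lsubst θ) hm
  | cons _ _ is hc =>
    rw [Term.names_appNames] at ht
    exact hc.appNames_typed hΦ.toRegular
      (fun i hi => ht (Finset.mem_union_right _ (List.mem_toFinset.2 hi))) hm
  | sort => exact .sort hm
  | pi _ _ hT ihA ihB =>
    have hA := ihA (hθ.mono Set.subset_union_left) (Finset.union_subset_left ht) ⟨_, .sort hm⟩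
    have hB := ihB (hθ.mono Set.subset_union_right) (Finset.union_subset_right ht) (.extCtx hA)
    exact .arrow hA (hB.red_type hΦ (hT.1.lsubst hΦ.toRegular θ))
  | app _ hT _ iht ihu =>
    have ht' := (iht (hθ.mono Set.subset_union_left) (Finset.union_subset_left ht) hm).red_type hΦ
      (hT.1.lsubst hΦ.toRegular θ)
    obtain ⟨s, hAB⟩ := (ht'.isType hΦ).resolve_left nofun
    have hu := ihu (hθ.mono Set.subset_union_right) (Finset.union_subset_right ht)
      ⟨_, hAB.pi_inv.1⟩
    rw [Term.lsubst_inst]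
    exact .app ht' hu

end UPP

theorem mainTheorem3 (Φ : UPP.LocalSig) (hΦ : Φ.WellFormed) (V : Finset ℕ)
    (Γ : UPP.Ctx) (D C : Set UPP.Constraint) (t A : UPP.Term) (ht : t.names ⊆ V) :
    (∀ s : UPP.Srt, UPP.TypedUnder Φ V D Γ A (.sort s) → UPP.Bidi Φ .check Γ D t A C →
      UPP.TypedUnder Φ V (C ∪ D) Γ t A) ∧
    (UPP.WfUnder Φ V D Γ → UPP.Bidi Φ .infer Γ D t A C →
      UPP.TypedUnder Φ V (C ∪ D) Γ t A) :=
  ⟨fun s hA h θ hθ => h.sound hΦ.valid (hθ.mono Set.subset_union_left) ht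
      ⟨s, hA θ (hθ.mono Set.subset_union_right)⟩,
    fun hΓ h θ hθ => h.sound hΦ.valid (hθ.mono Set.subset_union_left) ht
      (hΓ θ (hθ.mono Set.subset_union_right))⟩
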